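/- **Setting.** Consider an episodic Markov decision process with state space $\mathcal S$, action space $\mathcal A$, $H\ge 1$ steps, fixed initial state $s_1$, transition kernels $\mathbb P_h(\cdot\mid s,a)$ and deterministic rewards $r_h(s,a)\ge 0$ ($h\in[H]$) with $\sum_{h=1}^H r_h(s_h,a_h)\le 1$ along every possible trajectory. For a deterministic policy $\pi=(\pi_h)_{h\in[H]}$, $\pi_h:\mathcal S\to\mathcal A$, let $V^\pi_h$, $Q^\pi_h$ be its value functions, and let $V^\star_h=\sup_\pi V_h^\pi$, $Q^\star_h=\sup_\pi Q_h^\pi$. Write $(\mathcal T_h f)(s,a)=r_h(s,a)+\mathbb E_{s'\sim\mathbb P_h(\cdot\mid s,a)}\max_{a'}f(s',a')$. Let $\mathcal F=\mathcal F_1\times\dots\times\mathcal F_H$ and $\mathcal G=\mathcal G_1\times\dots\times\mathcal G_H$ with $\mathcal F_h,\mathcal G_h\subseteq(\mathcal S\times\mathcal A\to[0,1])$; put $f_{H+1}=0$ for $f\in\mathcal F$ and $\mathcal F_{H+1}=\{0\}$. Each $f\in\mathcal F$ has a greedy policy $\pi_f$, $\pi_{f,h}(s)\in\operatorname{argmax}_a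 f_h(s,a)$. (All functions, policies and the choices made by the algorithm are assumed measurable.) **Algorithm.** GOLF with parameters $(\mathcal F,\mathcal G,K,\beta)$ starts with empty data sets $\mathcal D_1,\dots,\mathcal D_H$ and $\mathcal B^0=\mathcal F$. In episode $k=1,\dots,K$ it chooses $f^k\in\operatorname{argmax}_{f\in\mathcal B^{k-1}}f_1(s_1,\pi_{f,1}(s_1))$, executes $\pi^k=\pi_{f^k}$ for one episode, adds the observed $(s_h,a_h,r_h,s_{h+1})$ to $\mathcal D_h$ for every $h$, and sets $$\mathcal B^k=\Big\{f\in\mathcal F:\ \mathcal L_{\mathcal D_h}(f_h,f_{h+1})\le\inf_{g\in\mathcal G_h}\mathcal L_{\mathcal D_h}(g,f_{h+1})+\beta\ \ \forall h\in[H]\Big\},\qquad \mathcal L_{\mathcal D_h}(\xi,\zeta)=\sum_{(s,a,r,s')\in\mathcal D_h}\big[\xi(s,a)-r-\max_{a'}\zeta(s',a')\big]^2 .$$ (The argmax is assumed to be attained whenever $\mathcal B^{k-1}\ne\emptyset$; if $\mathcal B^{k-1}=\emptyset$, then $f^k\in\mathcal F$ is arbitrary.) **Complexity measures.** $\mathcal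 N_{\mathcal F\cup\mathcal G}(\epsilon)$ is the least cardinality of a subset of $\mathcal F\cup\mathcal G$ that is an $\epsilon$-cover of $\mathcal F\cup\mathcal G$ for the metric $\max_h\|f_h-g_h\|_\infty$. For a class $\Phi$ of functions on $\mathcal X$, a probability measure $\nu$ is $\epsilon$-independent of $\mu_1,\dots,\mu_n$ if some $g\in\Phi$ satisfies $\sqrt{\sum_i(\mathbb E_{\mu_i}g)^2}\le\epsilon<|\mathbb E_\nu g|$; $\dim_{\mathrm{DE}}(\Phi,\Pi,\epsilon)$ is the largest length of a sequence in $\Pi$ such that, for some $\epsilon'\ge\epsilon$, each member is $\epsilon'$-independent of its predecessors; and $\dim_{\mathrm{BE}}(\mathcal F,\Pi,\epsilon)=\max_{h\in[H]}\dim_{\mathrm{DE}}(\{f_h-\mathcal T_hf_{h+1}:f\in\mathcal F\},\Pi_h,\epsilon)$. Let $\mathcal D_{\Delta,h}$ be the set of all point masses on $\mathcal S\times\mathcal A$, and $\mathcal D_{\mathcal F,h}$ the set of the laws of $(s_h,a_h)$ under the policies $\pi_f$, $f\in\mathcal F$. **Theorem (Regret of GOLF).** There are absolute constants $c,C>0$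 such that the following holds. Assume realizability, $Q^\star_h\in\mathcal F_h$ for all $h\in[H]$, and generalized completeness, $\mathcal T_h\mathcal F_{h+1}\subseteq\mathcal G_h$ for all $h\in[H]$. Let $\delta\in(0,1]$ and let $K\ge 2$ be an integer, assume that $\mathcal N_{\mathcal F\cup\mathcal G}(1/K)$ and $$d=\min_{\Pi\in\{\mathcal D_\Delta,\mathcal D_{\mathcal F}\}}\dim_{\mathrm{BE}}\big(\mathcal F,\Pi,1/\sqrt K\big)$$ are finite, and run GOLF with $\beta=c\log[\mathcal N_{\mathcal F\cup\mathcal G}(1/K)\cdot KH/\delta]$. Then, with probability at least $1-\delta$, for all $k\in[K]$, $$\mathrm{Reg}(k)=\sum_{t=1}^k\big[V_1^\star(s_1)-V_1^{\pi^t}(s_1)\big]\le C\,H\sqrt{\max\{d,1\}\,k\,\beta}.$$ -/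

import Mathlib

open MeasureTheory ProbabilityTheory
open scoped NNReal ENNReal

noncomputable section

namespace Golf

/-- The record of one episode with `n` steps: at step `h` it holds `((s_h, a_h), s_{h+1})`.
Steps are numbered from `0`, and rewards are deterministic functions of `(s_h, a_h)`. -/
abbrev Traj (S A : Type*) (n : ℕ) : Type _ := Fin n → (S × A) × S

/-- A tuple `(f_1, …, f_H)` of functions on state-action pairs. -/
abbrev QTuple (S A : Type*) (H : ℕ) : Type _ := Fin H → S × A → ℝ

/-- A deterministic policy with `n` steps. -/
abbrev Policy (S A : Type*) (n : ℕ) : Type _ := Fin n → S → A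

section Basic

variable {S A : Type*} [MeasurableSpace S] [MeasurableSpace A]

/-- The law of the trajectory that starts at `s`, takes the action `π_h(s_h)` at each step `h`
and moves to `s_{h+1} ∼ P_h(· ∣ s_h, a_h)`. -/
def trajLaw : (n : ℕ) → (Fin n → Kernel (S × A) S) → Policy S A n → S → Measure (Traj S A n)
  | 0, _, _, _ => Measure.dirac Fin.elim0
  | n + 1, P, π, s =>
      (P 0 (s, π 0 s)).bind fun s' =>
        (trajLaw n (fun i => P i.succ) (fun i => π i.succ) s').map
          (Fin.cons (α := fun _ => (S × A) × S) ((s, π 0 s), s'))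

variable (S A) in
/-- An episodic Markov decision process with `H` steps and a fixed initial state. Rewards are
nonnegative, and the total reward of an episode is at most `1` (almost surely, under every
policy). -/
structure MDP (H : ℕ) where
  /-- transition probabilities -/
  P : Fin H → Kernel (S × A) S
  markov : ∀ h, IsMarkovKernel (P h)
  /-- rewards -/
  r : Fin H → S × A → ℝ
  measurable_r : ∀ h, Measurable (r h)
  r_nonneg : ∀ h x, 0 ≤ r h x
  /-- initial state -/
  s₁ : S
  sum_r_le_one : ∀ π : Policy S A H, (∀ h, Measurable (π h)) →
    ∀ᵐ τ ∂(trajLaw H P π s₁), ∑ h, r h (τ h).1 ≤ 1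

/-- The entry of a tuple at step `j`, with the convention that it is `0` after the last step. -/
def entry {H : ℕ} (f : QTuple S A H) (j : ℕ) : S × A → ℝ :=
  if hj : j < H then f ⟨j, hj⟩ else 0

/-- The function class at step `j`, which is `{0}` after the last step. -/
def classAt {H : ℕ} (F : Fin H → Set (S × A → ℝ)) (j : ℕ) : Set (S × A → ℝ) :=
  if hj : j < H then F ⟨j, hj⟩ else {0}

/-- The product class `F_1 × ⋯ × F_H`. -/
def prodClass {H : ℕ} (F : Fin H → Set (S × A → ℝ)) : Set (QTuple S A H) := Set.univ.pi F

/-- The `ε`-covering number (with centres in the class) of a class of tuples for the metric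
`ρ(f, g) = max_h ‖f_h - g_h‖_∞`. -/
def coverNum {H : ℕ} (V : Set (QTuple S A H)) (ε : ℝ≥0) : ℕ∞ :=
  Metric.coveringNumber ε
    ((fun (f : QTuple S A H) (h : Fin H) => UniformFun.ofFun (f h)) '' V)

/-- `ν` is `ε`-independent of `μ_1, …, μ_n` with respect to the function class `Φ`. -/
def IsIndepOf {X : Type*} [MeasurableSpace X] (Φ : Set (X → ℝ)) (ε : ℝ) (ν : Measure X) {n : ℕ}
    (μ : Fin n → Measure X) : Prop :=
  ∃ g ∈ Φ, Real.sqrt (∑ i, (∫ x, g x ∂(μ i)) ^ 2) ≤ ε ∧ ε < |∫ x, g x ∂ν|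

/-- The distributional Eluder dimension: the supremum of the lengths `n` of sequences in `Ps`
such that, for some `ε' ≥ ε`, each member is `ε'`-independent of its predecessors. -/
def deDim {X : Type*} [MeasurableSpace X] (Φ : Set (X → ℝ)) (Ps : Set (Measure X)) (ε : ℝ) : ℕ∞ :=
  ⨆ (n : ℕ) (_ : ∃ ρ : Fin n → Measure X, (∀ i, ρ i ∈ Ps) ∧
    ∃ ε' : ℝ, ε ≤ ε' ∧ ∀ i : Fin n,
      IsIndepOf Φ ε' (ρ i) (fun j : Fin i => ρ (Fin.castLE i.isLt.le j))), (n : ℕ∞)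

namespace MDP

variable {H : ℕ} (M : MDP S A H)

/-- `V^π_h(s)`, the expected total reward from step `h` on, starting from `s_h = s`. -/
def V (π : Policy S A H) (h : ℕ) (s : S) : ℝ :=
  ∫ τ, ∑ i : Fin (H - h), M.r ⟨h + i, by omega⟩ (τ i).1
    ∂(trajLaw (H - h) (fun i => M.P ⟨h + i, by omega⟩) (fun i => π ⟨h + i, by omega⟩) s)

/-- `Q^π_h(s, a)`, the expected total reward from step `h` on, starting from `s_h = s`, `a_h = a`
and following `π` afterwards. -/
def Q (π : Policy S A H) (h : Fin H) (x : S × A) : ℝ :=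
  M.r h x + ∫ s', M.V π (h + 1) s' ∂(M.P h x)

/-- The optimal value function, a supremum over (measurable) policies. -/
def Vstar (h : ℕ) (s : S) : ℝ :=
  ⨆ π : {π : Policy S A H // ∀ h, Measurable (π h)}, M.V π.1 h s

/-- The optimal `Q`-function, a supremum over (measurable) policies. -/
def Qstar (h : Fin H) (x : S × A) : ℝ :=
  ⨆ π : {π : Policy S A H // ∀ h, Measurable (π h)}, M.Q π.1 h x

/-- The Bellman operator
`(T_h f)(s, a) = r_h(s, a) + E_{s' ∼ P_h(· ∣ s, a)} max_{a'} f(s', a')`. -/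
def bellman (h : Fin H) (f : S × A → ℝ) (x : S × A) : ℝ :=
  M.r h x + ∫ s', ⨆ a', f (s', a') ∂(M.P h x)

/-- The Bellman residuals `f_h - T_h f_{h+1}` of the tuples `f ∈ F`. -/
def residuals (F : Fin H → Set (S × A → ℝ)) (h : Fin H) : Set (S × A → ℝ) :=
  {g | ∃ f ∈ prodClass F, g = fun x => f h x - M.bellman h (entry f (h + 1)) x}

/-- The (Q-type) Bellman Eluder dimension. -/
def beDim (F : Fin H → Set (S × A → ℝ)) (Ps : Fin H → Set (Measure (S × A))) (ε : ℝ) : ℕ∞ :=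
  ⨆ h : Fin H, deDim (M.residuals F h) (Ps h) ε

/-- The family of the laws of `(s_h, a_h)` under the greedy policies `π_f` of the tuples
`f ∈ F`. -/
def greedyFamily (F : Fin H → Set (S × A → ℝ)) (greedy : QTuple S A H → Policy S A H)
    (h : Fin H) : Set (Measure (S × A)) :=
  {μ | ∃ f ∈ prodClass F, μ = (trajLaw H M.P (greedy f) M.s₁).map fun τ => (τ h).1}

/-- Realizability. -/
def Realizable (F : Fin H → Set (S × A → ℝ)) : Prop := ∀ h, M.Qstar h ∈ F h

/-- Generalized completeness. -/
def Complete (F G : Fin H → Set (S × A → ℝ)) : Prop :=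
  ∀ h : Fin H, M.bellman h '' classAt F (h + 1) ⊆ G h

/-- The squared loss of the pair `(ξ, ζ)` at step `h` on the data of `k` episodes. -/
def loss {k : ℕ} (D : Fin k → Traj S A H) (h : Fin H) (ξ ζ : S × A → ℝ) : ℝ :=
  ∑ t, (ξ (D t h).1 - M.r h (D t h).1 - ⨆ a', ζ ((D t h).2, a')) ^ 2

/-- The confidence set built from the data of `k` episodes. Without data the loss vanishes, so
that for `k = 0` (and `0 ≤ β`) this is all of `F`. -/
def confSet (F G : Fin H → Set (S × A → ℝ)) (β : ℝ) {k : ℕ} (D : Fin k → Traj S A H) :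
    Set (QTuple S A H) :=
  {f | f ∈ prodClass F ∧ ∀ h : Fin H,
    M.loss D h (f h) (entry f (h + 1)) ≤ (⨅ g : G h, M.loss D h g.1 (entry f (h + 1))) + β}

/-- The joint law of the first `k` episodes when, after the episodes recorded in
`D = (D_0, …, D_{t-1})`, the next episode follows the policy `pol t D`. -/
def runLaw (pol : (t : ℕ) → (Fin t → Traj S A H) → Policy S A H) :
    (k : ℕ) → Measure (Fin k → Traj S A H)
  | 0 => Measure.dirac Fin.elim0
  | k + 1 => (runLaw pol k).bind fun D =>
      (trajLaw H M.P (pol k D) M.s₁).map (Fin.snoc (α := fun _ => Traj S A H) D)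

/-- The regret of the first `k` of `K` episodes with record `D`. -/
def regret (pol : (t : ℕ) → (Fin t → Traj S A H) → Policy S A H) {K : ℕ}
    (D : Fin K → Traj S A H) (k : ℕ) (hk : k ≤ K) : ℝ :=
  ∑ t : Fin k, (M.Vstar 0 M.s₁ -
    M.V (pol t fun i : Fin t => D (Fin.castLE (t.isLt.le.trans hk) i)) 0 M.s₁)

end MDP

/-- `greedy` assigns to every tuple `f ∈ F` a greedy policy `π_f`, that is, a (measurable) policy
with `π_{f,h}(s) ∈ argmax_a f_h(s, a)`. -/
structure IsGreedy {H : ℕ} (F : Fin H → Set (S × A → ℝ))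
    (greedy : QTuple S A H → Policy S A H) : Prop where
  measurable : ∀ f ∈ prodClass F, ∀ h, Measurable (greedy f h)
  isMax : ∀ f ∈ prodClass F, ∀ h s a, f h (s, a) ≤ f h (s, greedy f h s)

/-- `sel` is the optimistic planning step of GOLF with parameters `F, G, K, β`: from the data `D`
of the `k` previous episodes it computes a maximizer of `f ↦ f_1(s_1, π_f(s_1))` over the
confidence set. If the confidence set is empty, the algorithm is not specified, and any member of
`F` may be chosen. The choice and its greedy policy depend measurably on the data. -/
structure IsGolf {H : ℕ} [NeZero H] (M : MDP S A H) (F G : Fin H → Set (S × A → ℝ)) (K : ℕ)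
    (β : ℝ) (greedy : QTuple S A H → Policy S A H)
    (sel : (k : ℕ) → (Fin k → Traj S A H) → QTuple S A H) : Prop where
  mem : ∀ k < K, ∀ D, sel k D ∈ prodClass F
  mem_confSet : ∀ k < K, ∀ D, (M.confSet F G β D).Nonempty → sel k D ∈ M.confSet F G β D
  isMax : ∀ k < K, ∀ D, ∀ f ∈ M.confSet F G β D,
    f 0 (M.s₁, greedy f 0 M.s₁) ≤ sel k D 0 (M.s₁, greedy (sel k D) 0 M.s₁)
  measurable_sel : ∀ k < K, ∀ h,
    Measurable fun p : (Fin k → Traj S A H) × (S × A) => sel k p.1 h p.2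
  measurable_policy : ∀ k < K, ∀ h,
    Measurable fun p : (Fin k → Traj S A H) × S => greedy (sel k p.1) h p.2

/-- The family of point masses on state-action pairs (the same at every step). -/
def diracFamily (S A : Type*) [MeasurableSpace S] [MeasurableSpace A] : Set (Measure (S × A)) :=
  Set.range Measure.dirac

end Basic

end Golf

end

/-
Optimism: with high probability `Q*` survives in every confidence set, because it is its own
regression target. Then `f^t_1(s_1, π^t_1(s_1))` dominates `V*_1(s_1)`, and telescoping along the
policy `π^t` bounds the regret by the sum over `h` and `t` of the expected Bellman residuals of
`f^t` under `π^t`.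

The residuals of a member of the confidence set are small in square sum over the past episodes,
both along the observed trajectories and in expectation under the played policies: the excess loss
of `f_h` over its Bellman backup concentrates around the squared residual, uniformly over finite
nets, by exponential supermartingales. A pigeonhole argument on the Bellman eluder dimension turns
this bound on the past into a bound of order `√(d k β)` on the sum of the present residuals.
-/

noncomputable section

namespace Golf

section BoundedFunctions

variable {α β : Type*} [MeasurableSpace α] [MeasurableSpace β]

/-- A bounded measurable real function: integrable for every finite measure, and stable under the
operations below, including integration against a Markov kernel. -/
def BddMeasurable (f : α → ℝ) : Prop := Measurable f ∧ ∃ B, ∀ a, |f a| ≤ B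

namespace BddMeasurable

variable {f g : α → ℝ}

lemma const (c : ℝ) : BddMeasurable fun _ : α => c := ⟨measurable_const, |c|, fun _ => le_rfl⟩

lemma comp {f : β → ℝ} (hf : BddMeasurable f) {φ : α → β} (hφ : Measurable φ) :
    BddMeasurable fun a => f (φ a) :=
  ⟨hf.1.comp hφ, hf.2.imp fun _ hB a => hB (φ a)⟩

lemma add (hf : BddMeasurable f) (hg : BddMeasurable g) : BddMeasurable fun a => f a + g a := by
  obtain ⟨hfm, B, hB⟩ := hf
  obtain ⟨hgm, C, hC⟩ := hg
  exact ⟨hfm.add hgm, B + C, fun a => (abs_add_le _ _).trans (add_le_add (hB a) (hC a))⟩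

lemma mul (hf : BddMeasurable f) (hg : BddMeasurable g) : BddMeasurable fun a => f a * g a := by
  obtain ⟨hfm, B, hB⟩ := hf
  obtain ⟨hgm, C, hC⟩ := hg
  exact ⟨hfm.mul hgm, B * C, fun a => by
    rw [abs_mul]
    exact mul_le_mul (hB a) (hC a) (abs_nonneg _) ((abs_nonneg _).trans (hB a))⟩

lemma sub (hf : BddMeasurable f) (hg : BddMeasurable g) : BddMeasurable fun a => f a - g a := by
  simpa only [neg_one_mul, ← sub_eq_add_neg] using hf.add ((const (-1)).mul hg)

lemma sq (hf : BddMeasurable f) : BddMeasurable fun a => f a ^ 2 := by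
  simpa only [pow_two] using hf.mul hf

lemma finset_sum {ι : Type*} {f : ι → α → ℝ} (s : Finset ι) (hf : ∀ i, BddMeasurable (f i)) :
    BddMeasurable fun a => ∑ i ∈ s, f i a := by
  classical
  induction s using Finset.induction_on with
  | empty => simpa only [Finset.sum_empty] using const 0
  | insert i s hi ih => simpa only [Finset.sum_insert hi] using (hf i).add ih

lemma integrable (hf : BddMeasurable f) (μ : Measure α) [IsFiniteMeasure μ] : Integrable f μ :=
  let ⟨hm, B, hB⟩ := hf
  Integrable.of_bound hm.aestronglyMeasurable B (.of_forall hB)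

end BddMeasurable

/-- A measurable function with values in `[0, 1]`, as all members of the function classes are. -/
def UnitMeasurable (f : α → ℝ) : Prop := Measurable f ∧ ∀ a, f a ∈ Set.Icc (0 : ℝ) 1

namespace UnitMeasurable

variable {f : α → ℝ}

lemma abs_le_one (hf : UnitMeasurable f) (a : α) : |f a| ≤ 1 := by
  rw [abs_of_nonneg (hf.2 a).1]
  exact (hf.2 a).2

lemma bdd (hf : UnitMeasurable f) : BddMeasurable f := ⟨hf.1, 1, hf.abs_le_one⟩

lemma integral_mem_Icc (hf : UnitMeasurable f) (μ : Measure α) [IsProbabilityMeasure μ] :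
    ∫ a, f a ∂μ ∈ Set.Icc (0 : ℝ) 1 := by
  refine ⟨integral_nonneg fun a => (hf.2 a).1, ?_⟩
  simpa using integral_mono (hf.bdd.integrable μ) (integrable_const 1) fun a => (hf.2 a).2

end UnitMeasurable

end BoundedFunctions

section MarkovFamilies

variable {α β γ : Type*} [MeasurableSpace α] [MeasurableSpace β] [MeasurableSpace γ]
  {κ : α → Measure β} [∀ a, IsProbabilityMeasure (κ a)]

lemma measurable_lintegral_of_measurable (hκ : Measurable κ) {F : α → β → ℝ≥0∞}
    (hF : Measurable fun p : α × β => F p.1 p.2) : Measurable fun a => ∫⁻ b, F a b ∂(κ a) :=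
  have : IsMarkovKernel (⟨κ, hκ⟩ : Kernel α β) := ⟨inferInstance⟩
  Measurable.lintegral_kernel_prod_right (κ := ⟨κ, hκ⟩) hF

lemma measurable_integral_of_measurable (hκ : Measurable κ) {F : α → β → ℝ}
    (hF : Measurable fun p : α × β => F p.1 p.2) : Measurable fun a => ∫ b, F a b ∂(κ a) :=
  have : IsMarkovKernel (⟨κ, hκ⟩ : Kernel α β) := ⟨inferInstance⟩
  (StronglyMeasurable.integral_kernel_prod_right (κ := ⟨κ, hκ⟩) hF.stronglyMeasurable).measurable

lemma measurable_map_of_measurable (hκ : Measurable κ) {F : α → β → γ}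
    (hF : Measurable fun p : α × β => F p.1 p.2) : Measurable fun a => (κ a).map (F a) := by
  have : IsMarkovKernel (⟨κ, hκ⟩ : Kernel α β) := ⟨inferInstance⟩
  refine Measure.measurable_of_measurable_coe _ fun s hs => ?_
  have hFa (a : α) : Measurable (F a) := hF.comp measurable_prodMk_left
  simp_rw [Measure.map_apply (hFa _) hs]
  exact Kernel.measurable_kernel_prodMk_left (κ := ⟨κ, hκ⟩) (hF hs)

lemma measurable_bind_of_measurable (hκ : Measurable κ) {η : α → β → Measure γ}
    (hη : Measurable fun p : α × β => η p.1 p.2) : Measurable fun a => (κ a).bind (η a) := by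
  refine Measure.measurable_of_measurable_coe _ fun s hs => ?_
  have hηa (a : α) : Measurable (η a) := hη.comp measurable_prodMk_left
  simp_rw [Measure.bind_apply hs (hηa _).aemeasurable]
  exact measurable_lintegral_of_measurable hκ ((Measure.measurable_coe hs).comp hη)

lemma BddMeasurable.integral (hκ : Measurable κ) {f : β → ℝ} (hf : BddMeasurable f) :
    BddMeasurable fun a => ∫ b, f b ∂(κ a) := by
  obtain ⟨hm, B, hB⟩ := hf
  refine ⟨measurable_integral_of_measurable hκ (hm.comp measurable_snd), B, fun a => ?_⟩
  simpa using norm_integral_le_of_norm_le_const (μ := κ a) (f := f) (.of_forall hB)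

lemma isProbabilityMeasure_bind (μ : Measure α) [IsProbabilityMeasure μ] (hκ : Measurable κ) :
    IsProbabilityMeasure (μ.bind κ) :=
  ⟨by simp [Measure.bind_apply MeasurableSet.univ hκ.aemeasurable]⟩

lemma BddMeasurable.integral_bind (μ : Measure α) [IsProbabilityMeasure μ] (hκ : Measurable κ)
    {f : β → ℝ} (hf : BddMeasurable f) : ∫ b, f b ∂(μ.bind κ) = ∫ a, ∫ b, f b ∂(κ a) ∂μ := by
  have := isProbabilityMeasure_bind μ hκ
  simpa [Kernel.comp_apply] using Kernel.integral_comp (κ := Kernel.const Unit μ)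
    (η := ⟨κ, hκ⟩) (a := ()) (f := f) (by simpa [Kernel.comp_apply] using hf.integrable _)

end MarkovFamilies

section Trajectories

variable {S A Ω : Type*} [MeasurableSpace S] [MeasurableSpace A] [MeasurableSpace Ω]

lemma measurable_finCons {X : Type*} [MeasurableSpace X] {n : ℕ} :
    Measurable fun p : X × (Fin n → X) => (Fin.cons p.1 p.2 : Fin (n + 1) → X) := by
  refine measurable_pi_iff.2 (Fin.cases ?_ fun j => ?_)
  · simpa only [Fin.cons_zero] using measurable_fst
  · simp only [Fin.cons_succ]
    exact (measurable_pi_apply j).comp measurable_snd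

lemma measurable_finSnoc {X : Type*} [MeasurableSpace X] {n : ℕ} :
    Measurable fun p : (Fin n → X) × X => (Fin.snoc p.1 p.2 : Fin (n + 1) → X) := by
  refine measurable_pi_iff.2 (Fin.lastCases ?_ fun j => ?_)
  · simpa only [Fin.snoc_last] using measurable_snd
  · simp only [Fin.snoc_castSucc]
    exact (measurable_pi_apply j).comp measurable_fst

lemma measurable_visit {n : ℕ} (h : Fin n) : Measurable fun τ : Traj S A n => (τ h).1 :=
  measurable_fst.comp (measurable_pi_apply h)

lemma measurable_trajLaw_and_isProbabilityMeasure (n : ℕ) (P : Fin n → Kernel (S × A) S)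
    [∀ i, IsMarkovKernel (P i)] (π : Ω → Policy S A n)
    (hπ : ∀ i, Measurable fun p : Ω × S => π p.1 i p.2) :
    (Measurable fun p : Ω × S => trajLaw n P (π p.1) p.2) ∧
      ∀ p : Ω × S, IsProbabilityMeasure (trajLaw n P (π p.1) p.2) := by
  induction n with
  | zero =>
    simp only [trajLaw]
    exact ⟨measurable_const, fun _ => inferInstance⟩
  | succ n ih =>
    obtain ⟨ihm, ihp⟩ := ih (fun i => P i.succ) (fun ω i => π ω i.succ) fun i => hπ i.succ
    have hvisit : Measurable fun p : Ω × S => (p.2, π p.1 0 p.2) := measurable_snd.prodMk (hπ 0)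
    have htail : Measurable fun q : (Ω × S) × S =>
        trajLaw n (fun i => P i.succ) (fun i => π q.1.1 i.succ) q.2 :=
      ihm.comp ((measurable_fst.comp measurable_fst).prodMk measurable_snd)
    have hcons : Measurable fun p : ((Ω × S) × S) × Traj S A n =>
        (Fin.cons ((p.1.1.2, π p.1.1.1 0 p.1.1.2), p.1.2) p.2 : Traj S A (n + 1)) :=
      measurable_finCons.comp (((hvisit.comp (measurable_fst.comp measurable_fst)).prodMk
        (measurable_snd.comp measurable_fst)).prodMk measurable_snd)
    have (q : (Ω × S) × S) :
        IsProbabilityMeasure (trajLaw n (fun i => P i.succ) (fun i => π q.1.1 i.succ) q.2) :=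
      ihp (q.1.1, q.2)
    have hstep := measurable_map_of_measurable (F := fun q : (Ω × S) × S =>
      Fin.cons (α := fun _ => (S × A) × S) ((q.1.2, π q.1.1 0 q.1.2), q.2)) htail hcons
    refine ⟨measurable_bind_of_measurable (κ := fun p : Ω × S => P 0 (p.2, π p.1 0 p.2))
      ((P 0).measurable.comp hvisit) hstep, fun p => ?_⟩
    have (s' : S) : IsProbabilityMeasure
        ((trajLaw n (fun i => P i.succ) (fun i => π p.1 i.succ) s').map
          (Fin.cons (α := fun _ => (S × A) × S) ((p.2, π p.1 0 p.2), s'))) :=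
      have := ihp (p.1, s')
      Measure.isProbabilityMeasure_map (measurable_finCons.comp measurable_prodMk_left).aemeasurable
    exact isProbabilityMeasure_bind _ (hstep.comp measurable_prodMk_left)

lemma measurable_trajLaw_param {n : ℕ} {P : Fin n → Kernel (S × A) S} [∀ i, IsMarkovKernel (P i)]
    {π : Ω → Policy S A n} (hπ : ∀ i, Measurable fun p : Ω × S => π p.1 i p.2) (s : S) :
    Measurable fun ω : Ω => trajLaw n P (π ω) s :=
  (measurable_trajLaw_and_isProbabilityMeasure n P π hπ).1.comp measurable_prodMk_right

section FixedPolicy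

variable {n : ℕ} {P : Fin n → Kernel (S × A) S} [∀ i, IsMarkovKernel (P i)] {π : Policy S A n}

lemma measurable_trajLaw (hπ : ∀ i, Measurable (π i)) : Measurable fun s => trajLaw n P π s :=
  (measurable_trajLaw_and_isProbabilityMeasure (Ω := Unit) n P (fun _ => π)
    fun i => (hπ i).comp measurable_snd).1.comp (measurable_prodMk_left (x := ()))

lemma isProbabilityMeasure_trajLaw (hπ : ∀ i, Measurable (π i)) (s : S) :
    IsProbabilityMeasure (trajLaw n P π s) :=
  (measurable_trajLaw_and_isProbabilityMeasure (Ω := Unit) n P (fun _ => π)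
    fun i => (hπ i).comp measurable_snd).2 ((), s)

end FixedPolicy

section FirstStep

variable {n : ℕ} {P : Fin (n + 1) → Kernel (S × A) S} [∀ i, IsMarkovKernel (P i)]
  {π : Policy S A (n + 1)}

lemma measurable_map_cons_trajLaw (hπ : ∀ i, Measurable (π i)) (x : S × A) :
    Measurable fun s' => (trajLaw n (fun i => P i.succ) (fun i => π i.succ) s').map
      (Fin.cons (α := fun _ => (S × A) × S) (x, s')) :=
  have (s' : S) := isProbabilityMeasure_trajLaw (P := fun i => P i.succ) (fun i => hπ i.succ) s'
  measurable_map_of_measurable (F := fun s' => Fin.cons (α := fun _ => (S × A) × S) (x, s'))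
    (measurable_trajLaw fun i => hπ i.succ)
    (measurable_finCons.comp ((measurable_const.prodMk measurable_fst).prodMk measurable_snd))

lemma lintegral_trajLaw_succ (hπ : ∀ i, Measurable (π i)) (s : S)
    {g : Traj S A (n + 1) → ℝ≥0∞} (hg : Measurable g) :
    ∫⁻ τ, g τ ∂(trajLaw (n + 1) P π s) =
      ∫⁻ s', ∫⁻ τ, g (Fin.cons ((s, π 0 s), s') τ)
        ∂(trajLaw n (fun i => P i.succ) (fun i => π i.succ) s') ∂(P 0 (s, π 0 s)) := by
  rw [trajLaw, Measure.lintegral_bind (measurable_map_cons_trajLaw hπ _).aemeasurable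
    hg.aemeasurable]
  exact lintegral_congr fun s' =>
    lintegral_map hg (measurable_finCons.comp measurable_prodMk_left)

lemma integral_trajLaw_succ (hπ : ∀ i, Measurable (π i)) (s : S)
    {g : Traj S A (n + 1) → ℝ} (hg : BddMeasurable g) :
    ∫ τ, g τ ∂(trajLaw (n + 1) P π s) =
      ∫ s', ∫ τ, g (Fin.cons ((s, π 0 s), s') τ)
        ∂(trajLaw n (fun i => P i.succ) (fun i => π i.succ) s') ∂(P 0 (s, π 0 s)) := by
  have hcons (s' : S) : Measurable (Fin.cons (α := fun _ => (S × A) × S) ((s, π 0 s), s') :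
      Traj S A n → Traj S A (n + 1)) := measurable_finCons.comp measurable_prodMk_left
  have (s' : S) : IsProbabilityMeasure
      ((trajLaw n (fun i => P i.succ) (fun i => π i.succ) s').map
        (Fin.cons (α := fun _ => (S × A) × S) ((s, π 0 s), s'))) :=
    have := isProbabilityMeasure_trajLaw (P := fun i => P i.succ) (fun i => hπ i.succ) s'
    Measure.isProbabilityMeasure_map (hcons s').aemeasurable
  rw [trajLaw, hg.integral_bind _ (measurable_map_cons_trajLaw hπ _)]
  exact integral_congr_ae (.of_forall fun s' =>
    integral_map (hcons s').aemeasurable hg.1.aestronglyMeasurable)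

end FirstStep

lemma lintegral_trajLaw_markov {n : ℕ} {P : Fin n → Kernel (S × A) S} [∀ i, IsMarkovKernel (P i)]
    {π : Policy S A n} (hπ : ∀ i, Measurable (π i)) (s : S) (h : Fin n)
    {g : (S × A) × S → ℝ≥0∞} (hg : Measurable g) :
    ∫⁻ τ, g (τ h) ∂(trajLaw n P π s) =
      ∫⁻ τ, ∫⁻ s', g ((τ h).1, s') ∂(P h (τ h).1) ∂(trajLaw n P π s) := by
  induction n generalizing s with
  | zero => exact h.elim0
  | succ n ih =>
    have hinner : Measurable fun x : S × A => ∫⁻ s', g (x, s') ∂(P h x) :=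
      measurable_lintegral_of_measurable (P h).measurable hg
    rw [lintegral_trajLaw_succ hπ s (g := fun τ => g (τ h)) (hg.comp (measurable_pi_apply h)),
      lintegral_trajLaw_succ hπ s (g := fun τ => ∫⁻ s', g ((τ h).1, s') ∂(P h (τ h).1))
        (hinner.comp (measurable_visit h))]
    clear hinner
    induction h using Fin.cases with
    | zero =>
      have (s' : S) := isProbabilityMeasure_trajLaw (P := fun i => P i.succ)
        (fun i => hπ i.succ) s'
      simp
    | succ j =>
      simp only [Fin.cons_succ]
      exact lintegral_congr fun s' => ih (fun i => hπ i.succ) s' j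

end Trajectories

section Values

variable {S A : Type*} [MeasurableSpace S] [MeasurableSpace A]

/-- The expected total of `r_0(x_0) + ⋯ + r_{n-1}(x_{n-1})` along a trajectory from `s`, for
arbitrary functions `r_i`: besides rewards, they can be Bellman residuals. -/
def val (n : ℕ) (P : Fin n → Kernel (S × A) S) (r : Fin n → S × A → ℝ) (π : Policy S A n)
    (s : S) : ℝ :=
  ∫ τ, ∑ i, r i (τ i).1 ∂(trajLaw n P π s)

lemma bddMeasurable_sum_visit {n : ℕ} {r : Fin n → S × A → ℝ} (hr : ∀ i, BddMeasurable (r i)) :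
    BddMeasurable fun τ : Traj S A n => ∑ i, r i (τ i).1 :=
  .finset_sum _ fun i => (hr i).comp (measurable_visit i)

lemma bddMeasurable_val {n : ℕ} {P : Fin n → Kernel (S × A) S} [∀ i, IsMarkovKernel (P i)]
    {r : Fin n → S × A → ℝ} (hr : ∀ i, BddMeasurable (r i)) {π : Policy S A n}
    (hπ : ∀ i, Measurable (π i)) : BddMeasurable (val n P r π) :=
  have := isProbabilityMeasure_trajLaw (P := P) hπ
  .integral (measurable_trajLaw hπ) (bddMeasurable_sum_visit hr)

lemma val_succ {n : ℕ} {P : Fin (n + 1) → Kernel (S × A) S} [∀ i, IsMarkovKernel (P i)]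
    {r : Fin (n + 1) → S × A → ℝ} (hr : ∀ i, BddMeasurable (r i)) {π : Policy S A (n + 1)}
    (hπ : ∀ i, Measurable (π i)) (s : S) :
    val (n + 1) P r π s = r 0 (s, π 0 s) +
      ∫ s', val n (fun i => P i.succ) (fun i => r i.succ) (fun i => π i.succ) s'
        ∂(P 0 (s, π 0 s)) := by
  have hprob := isProbabilityMeasure_trajLaw (P := fun i => P i.succ) fun i => hπ i.succ
  have htail := bddMeasurable_sum_visit fun i => hr i.succ
  have hval := bddMeasurable_val (P := fun i => P i.succ) (fun i => hr i.succ) fun i => hπ i.succ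
  rw [val, integral_trajLaw_succ hπ s (bddMeasurable_sum_visit hr)]
  simp only [Fin.sum_univ_succ, Fin.cons_zero, Fin.cons_succ]
  simp_rw [integral_add (integrable_const _) (htail.integrable _), integral_const,
    probReal_univ, one_smul]
  refine (integral_add (integrable_const _) (hval.integrable _)).trans ?_
  simp

lemma val_residual {n : ℕ} {P : Fin n → Kernel (S × A) S} [∀ i, IsMarkovKernel (P i)]
    {r q : Fin n → S × A → ℝ} (hr : ∀ i, BddMeasurable (r i)) (hq : ∀ i, BddMeasurable (q i))
    {π : Policy S A n} (hπ : ∀ i, Measurable (π i)) {v : Fin (n + 1) → S → ℝ}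
    (hv : ∀ (i : Fin n) s, v i.castSucc s = q i (s, π i s)) (hlast : ∀ s, v (Fin.last n) s = 0)
    (s : S) :
    val n P (fun i x => q i x - (r i x + ∫ s', v i.succ s' ∂(P i x))) π s =
      v 0 s - val n P r π s := by
  induction n generalizing s with
  | zero => simpa [val] using (hlast s).symm
  | succ n ih =>
    have hvb : ∀ i, BddMeasurable (v i) := by
      refine Fin.lastCases ?_ fun i => ?_
      · exact funext hlast ▸ .const 0
      · exact funext (hv i) ▸ (hq i).comp (measurable_id.prodMk (hπ i))
    have hres (i : Fin (n + 1)) :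
        BddMeasurable fun x => q i x - (r i x + ∫ s', v i.succ s' ∂(P i x)) :=
      (hq i).sub ((hr i).add (.integral (P i).measurable (hvb i.succ)))
    have htail := ih (P := fun i => P i.succ) (fun i => hr i.succ) (fun i => hq i.succ)
      (fun i => hπ i.succ) (v := fun i => v i.succ) (fun i => hv i.succ) hlast
    have hval := bddMeasurable_val (P := fun i => P i.succ) (fun i => hr i.succ)
      fun i => hπ i.succ
    rw [val_succ hres hπ s, val_succ hr hπ s]
    simp_rw [htail]
    rw [integral_sub ((hvb _).integrable _) (hval.integrable _),
      show v 0 s = q 0 (s, π 0 s) from hv 0 s]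
    ring

end Values

section GreedyPolicies

variable {S A : Type*} {H : ℕ}

/-- The function `s ↦ max_a f(s, a)`. -/
def maxVal (f : S × A → ℝ) (s : S) : ℝ := ⨆ a, f (s, a)

lemma maxVal_zero : maxVal (0 : S × A → ℝ) = 0 := by
  funext s
  simp [maxVal]

lemma entry_of_lt (f : QTuple S A H) {j : ℕ} (hj : j < H) : entry f j = f ⟨j, hj⟩ := dif_pos hj

lemma entry_of_le (f : QTuple S A H) {j : ℕ} (hj : H ≤ j) : entry f j = 0 := dif_neg hj.not_gt

lemma entry_mem_classAt {F : Fin H → Set (S × A → ℝ)} {f : QTuple S A H} (hf : f ∈ prodClass F)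
    (j : ℕ) : entry f j ∈ classAt F j := by
  by_cases hj : j < H
  · simpa [entry, classAt, hj] using hf ⟨j, hj⟩ trivial
  · simp [entry, classAt, hj]

variable [MeasurableSpace S] [MeasurableSpace A]

/-- `π` is a (measurable) greedy policy of the tuple `f`. -/
structure IsGreedyPolicy (f : QTuple S A H) (π : Policy S A H) : Prop where
  measurable : ∀ h, Measurable (π h)
  isMax : ∀ h s a, f h (s, a) ≤ f h (s, π h s)

lemma IsGreedy.isGreedyPolicy {F : Fin H → Set (S × A → ℝ)}
    {greedy : QTuple S A H → Policy S A H} (hg : IsGreedy F greedy) {f : QTuple S A H}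
    (hf : f ∈ prodClass F) : IsGreedyPolicy f (greedy f) :=
  ⟨hg.measurable f hf, hg.isMax f hf⟩

namespace IsGreedyPolicy

variable {f : QTuple S A H} {π : Policy S A H}

lemma maxVal_eq (hπ : IsGreedyPolicy f π) (h : Fin H) (s : S) :
    maxVal (f h) s = f h (s, π h s) :=
  have : Nonempty A := ⟨π h s⟩
  le_antisymm (ciSup_le (hπ.isMax h s))
    (le_ciSup (f := fun a => f h (s, a)) ⟨_, Set.forall_mem_range.2 (hπ.isMax h s)⟩ _)

lemma unitMeasurable_maxVal_entry (hπ : IsGreedyPolicy f π) (hf : ∀ h, UnitMeasurable (f h))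
    (j : ℕ) : UnitMeasurable (maxVal (entry f j)) := by
  obtain hj | hj := lt_or_ge j H
  · rw [entry_of_lt _ hj, funext (hπ.maxVal_eq _)]
    exact ⟨(hf _).1.comp (measurable_id.prodMk (hπ.measurable _)), fun s => (hf _).2 _⟩
  · rw [entry_of_le _ hj, maxVal_zero]
    exact ⟨measurable_const, fun _ => by simp⟩

end IsGreedyPolicy

end GreedyPolicies

namespace MDP

variable {S A : Type*} [MeasurableSpace S] [MeasurableSpace A] {H : ℕ} {M : MDP S A H}

instance (M : MDP S A H) (h : Fin H) : IsMarkovKernel (M.P h) := M.markov h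

section ValueFunctions

variable {π : Policy S A H} {h : ℕ}

lemma V_eq_val (π : Policy S A H) (h : ℕ) :
    M.V π h = val (H - h) (fun i => M.P ⟨h + i, by omega⟩) (fun i => M.r ⟨h + i, by omega⟩)
      fun i => π ⟨h + i, by omega⟩ := rfl

lemma V_zero_eq_val (π : Policy S A H) : M.V π 0 = val H M.P M.r π := by
  have hstep (i : Fin H) : (⟨0 + i, by omega⟩ : Fin H) = i := Fin.ext (Nat.zero_add _)
  change val H (fun i => M.P ⟨0 + i, by omega⟩) (fun i => M.r ⟨0 + i, by omega⟩)
    (fun i => π ⟨0 + i, by omega⟩) = _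
  simp only [hstep]

lemma V_of_le (π : Policy S A H) (hh : H ≤ h) (s : S) : M.V π h s = 0 := by
  have : IsEmpty (Fin (H - h)) := by rw [Nat.sub_eq_zero_of_le hh]; infer_instance
  simp [V]

lemma V_nonneg (π : Policy S A H) (h : ℕ) (s : S) : 0 ≤ M.V π h s :=
  integral_nonneg fun _ => Finset.sum_nonneg fun _ _ => M.r_nonneg _ _

lemma V_le (hπ : ∀ h, Measurable (π h)) (hr : ∀ j : Fin H, h ≤ j → ∀ x, M.r j x ≤ 1) (s : S) :
    M.V π h s ≤ H := by
  have := isProbabilityMeasure_trajLaw (P := fun i : Fin (H - h) => M.P ⟨h + i, by omega⟩)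
    (π := fun i => π ⟨h + i, by omega⟩) (fun i => hπ _) s
  have hsum (τ : Traj S A (H - h)) : ∑ i : Fin (H - h), M.r ⟨h + i, by omega⟩ (τ i).1 ≤ H :=
    calc _ ≤ ∑ _i : Fin (H - h), (1 : ℝ) := Finset.sum_le_sum fun i _ => hr _ (by simp) _
      _ ≤ H := by simp
  refine (integral_mono_of_nonneg (.of_forall fun _ => Finset.sum_nonneg fun _ _ =>
    M.r_nonneg _ _) (integrable_const _) (.of_forall hsum)).trans ?_
  simp

lemma bddMeasurable_r (hr : ∀ h x, M.r h x ≤ 1) (h : Fin H) : BddMeasurable (M.r h) :=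
  UnitMeasurable.bdd ⟨M.measurable_r h, fun x => ⟨M.r_nonneg h x, hr h x⟩⟩

lemma bddMeasurable_V (hr : ∀ h x, M.r h x ≤ 1) (hπ : ∀ h, Measurable (π h)) (h : ℕ) :
    BddMeasurable (M.V π h) :=
  bddMeasurable_val (fun _ => bddMeasurable_r hr _) fun _ => hπ _

lemma val_of_eq_succ {m n : ℕ} (hm : m = n + 1) {P : Fin m → Kernel (S × A) S}
    [∀ i, IsMarkovKernel (P i)] {r : Fin m → S × A → ℝ} (hr : ∀ i, BddMeasurable (r i))
    {π : Policy S A m} (hπ : ∀ i, Measurable (π i)) (s : S) :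
    val m P r π s = r ⟨0, by omega⟩ (s, π ⟨0, by omega⟩ s) +
      ∫ s', val n (fun i => P ⟨i + 1, by omega⟩) (fun i => r ⟨i + 1, by omega⟩)
        (fun i => π ⟨i + 1, by omega⟩) s' ∂(P ⟨0, by omega⟩ (s, π ⟨0, by omega⟩ s)) := by
  subst hm
  exact val_succ hr hπ s

lemma V_eq_Q (hr : ∀ h x, M.r h x ≤ 1) (hπ : ∀ h, Measurable (π h)) (h : Fin H) (s : S) :
    M.V π h s = M.Q π h (s, π h s) := by
  have hstep : ∀ i : Fin (H - (h + 1)),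
      (⟨h + 1 + i, by omega⟩ : Fin H) = ⟨h + (i + 1), by omega⟩ :=
    fun i => Fin.ext (by dsimp only; omega)
  rw [V_eq_val, val_of_eq_succ (n := H - (h + 1)) (by omega) (fun i => bddMeasurable_r hr _)
    (fun i => hπ _), Q, V_eq_val]
  simp only [hstep]
  rfl

end ValueFunctions

section Optimality

variable {π : Policy S A H}

lemma Q_le_Qstar (hπ : ∀ h, Measurable (π h)) {h : Fin H}
    (hr : ∀ j > h, ∀ x, M.r j x ≤ 1) (x : S × A) : M.Q π h x ≤ M.Qstar h x := by
  refine le_ciSup (f := fun π : {π : Policy S A H // ∀ h, Measurable (π h)} => M.Q π.1 h x)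
    ⟨M.r h x + H, ?_⟩ ⟨π, hπ⟩
  rintro _ ⟨ρ, rfl⟩
  refine add_le_add_right ?_ _
  refine (integral_mono_of_nonneg (.of_forall (M.V_nonneg ρ.1 _)) (integrable_const (H : ℝ))
    (.of_forall fun s' => V_le ρ.2 (fun j hj => hr j (Fin.lt_def.2 hj)) s')).trans ?_
  simp

lemma r_le_one (hπ : ∀ h, Measurable (π h)) (hQ : ∀ h x, M.Qstar h x ≤ 1) (h : Fin H)
    (x : S × A) : M.r h x ≤ 1 := by
  induction h using WellFoundedGT.induction generalizing x with
  | ind h ih =>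
    have hrQ : M.r h x ≤ M.Q π h x :=
      le_add_of_nonneg_right (integral_nonneg fun s' => M.V_nonneg π _ s')
    exact hrQ.trans ((Q_le_Qstar hπ ih x).trans (hQ h x))

lemma Qstar_eq_Q (hr : ∀ h x, M.r h x ≤ 1) (hπ : IsGreedyPolicy M.Qstar π) (h : Fin H)
    (x : S × A) : M.Qstar h x = M.Q π h x := by
  induction h using WellFoundedGT.induction generalizing x with
  | ind h ih =>
    have : Nonempty {π : Policy S A H // ∀ h, Measurable (π h)} := ⟨⟨π, hπ.measurable⟩⟩
    refine le_antisymm (ciSup_le fun ρ => ?_) (Q_le_Qstar hπ.measurable (fun j _ => hr j) x)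
    refine add_le_add_right (integral_mono ((bddMeasurable_V hr ρ.2 _).integrable _)
      ((bddMeasurable_V hr hπ.measurable _).integrable _) fun s => ?_) _
    obtain hlt | hle := lt_or_ge ((h : ℕ) + 1) H
    · calc M.V ρ.1 (h + 1) s = M.Q ρ.1 ⟨h + 1, hlt⟩ (s, ρ.1 ⟨h + 1, hlt⟩ s) :=
            V_eq_Q hr ρ.2 ⟨h + 1, hlt⟩ s
        _ ≤ M.Qstar ⟨h + 1, hlt⟩ (s, ρ.1 ⟨h + 1, hlt⟩ s) := Q_le_Qstar ρ.2 (fun j _ => hr j) _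
        _ ≤ M.Qstar ⟨h + 1, hlt⟩ (s, π ⟨h + 1, hlt⟩ s) := hπ.isMax _ _ _
        _ = M.Q π ⟨h + 1, hlt⟩ (s, π ⟨h + 1, hlt⟩ s) := ih _ (Nat.lt_succ_self _) _
        _ = M.V π (h + 1) s := (V_eq_Q hr hπ.measurable ⟨h + 1, hlt⟩ s).symm
    · simp only [V_of_le _ hle, le_refl]

lemma bellman_apply (h : Fin H) (f : S × A → ℝ) (x : S × A) :
    M.bellman h f x = M.r h x + ∫ s', maxVal f s' ∂(M.P h x) := rfl

lemma bellman_entry_Qstar (hr : ∀ h x, M.r h x ≤ 1) (hπ : IsGreedyPolicy M.Qstar π) (h : Fin H) :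
    M.bellman h (entry M.Qstar (h + 1)) = M.Qstar h := by
  funext x
  rw [Qstar_eq_Q hr hπ, bellman_apply, Q]
  congr 2
  funext s
  obtain hlt | hle := lt_or_ge ((h : ℕ) + 1) H
  · rw [entry_of_lt _ hlt, hπ.maxVal_eq, Qstar_eq_Q hr hπ]
    exact (V_eq_Q hr hπ.measurable ⟨h + 1, hlt⟩ s).symm
  · rw [entry_of_le _ hle, V_of_le _ hle, maxVal_zero, Pi.zero_apply]

lemma Vstar_zero_le_Qstar [NeZero H] (hr : ∀ h x, M.r h x ≤ 1) (hπ : IsGreedyPolicy M.Qstar π)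
    (s : S) : M.Vstar 0 s ≤ M.Qstar 0 (s, π 0 s) :=
  have : Nonempty {π : Policy S A H // ∀ h, Measurable (π h)} := ⟨⟨π, hπ.measurable⟩⟩
  ciSup_le fun ρ =>
    calc M.V ρ.1 0 s = M.Q ρ.1 0 (s, ρ.1 0 s) := V_eq_Q hr ρ.2 0 s
      _ ≤ M.Qstar 0 (s, ρ.1 0 s) := Q_le_Qstar ρ.2 (fun j _ => hr j) _
      _ ≤ M.Qstar 0 (s, π 0 s) := hπ.isMax _ _ _

end Optimality

section PolicyLoss

/-- The error `u - T_h ζ` of `u` as an estimate of the Bellman backup of `ζ`. -/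
def bellmanErr (M : MDP S A H) (h : Fin H) (u ζ : S × A → ℝ) (x : S × A) : ℝ :=
  u x - M.bellman h ζ x

/-- The Bellman residual `f_h - T_h f_{h+1}`. -/
abbrev resid (M : MDP S A H) (f : QTuple S A H) (h : Fin H) : S × A → ℝ :=
  M.bellmanErr h (f h) (entry f (h + 1))

/-- The law of `(s_h, a_h)` under a policy. -/
def occ (M : MDP S A H) (π : Policy S A H) (h : Fin H) : Measure (S × A) :=
  (trajLaw H M.P π M.s₁).map fun τ => (τ h).1

variable {π : Policy S A H}

lemma isProbabilityMeasure_occ (hπ : ∀ h, Measurable (π h)) (h : Fin H) :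
    IsProbabilityMeasure (M.occ π h) :=
  have := isProbabilityMeasure_trajLaw (P := M.P) hπ M.s₁
  Measure.isProbabilityMeasure_map (measurable_visit h).aemeasurable

lemma integral_occ (π : Policy S A H) (h : Fin H) {g : S × A → ℝ} (hg : Measurable g) :
    ∫ x, g x ∂(M.occ π h) = ∫ τ, g (τ h).1 ∂(trajLaw H M.P π M.s₁) :=
  integral_map (measurable_visit h).aemeasurable hg.aestronglyMeasurable

lemma bddMeasurable_bellmanErr (hr : ∀ h x, M.r h x ≤ 1) (h : Fin H) {u ζ : S × A → ℝ}
    (hu : BddMeasurable u) (hζ : BddMeasurable (maxVal ζ)) :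
    BddMeasurable (M.bellmanErr h u ζ) :=
  hu.sub ((bddMeasurable_r hr h).add (.integral (M.P h).measurable hζ))

lemma sub_V_eq_sum_integral_resid [NeZero H] (hr : ∀ h x, M.r h x ≤ 1) {f : QTuple S A H}
    (hf : ∀ h, UnitMeasurable (f h)) (hπ : IsGreedyPolicy f π) :
    f 0 (M.s₁, π 0 M.s₁) - M.V π 0 M.s₁ = ∑ h, ∫ x, M.resid f h x ∂(M.occ π h) := by
  have hprob := isProbabilityMeasure_trajLaw (P := M.P) hπ.measurable M.s₁
  have hres (h : Fin H) : BddMeasurable (M.resid f h) :=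
    bddMeasurable_bellmanErr hr h (hf h).bdd (hπ.unitMeasurable_maxVal_entry hf _).bdd
  have htele : val H M.P (M.resid f) π M.s₁ = maxVal (entry f 0) M.s₁ - val H M.P M.r π M.s₁ :=
    val_residual (v := fun i => maxVal (entry f i)) (bddMeasurable_r hr) (fun h => (hf h).bdd)
      hπ.measurable (fun h s => by rw [Fin.val_castSucc, entry_of_lt f h.2, hπ.maxVal_eq])
      (fun s => by rw [Fin.val_last, entry_of_le f le_rfl, maxVal_zero, Pi.zero_apply]) M.s₁
  rw [V_zero_eq_val, show f 0 (M.s₁, π 0 M.s₁) = maxVal (entry f 0) M.s₁ by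
    rw [entry_of_lt f (NeZero.pos H)]; exact (hπ.maxVal_eq 0 M.s₁).symm, ← htele, val,
    integral_finsetSum _ fun h _ => ((hres h).comp (measurable_visit h)).integrable _]
  exact Finset.sum_congr rfl fun h _ => (integral_occ π h (hres h).1).symm

end PolicyLoss

end MDP

namespace MDP

variable {S A : Type*} [MeasurableSpace S] [MeasurableSpace A] {H : ℕ} {M : MDP S A H}

section Runs

variable {pol : (t : ℕ) → (Fin t → Traj S A H) → Policy S A H} {K k n : ℕ}

/-- The policy of each of the first `K` episodes depends measurably on the data. -/
def MeasurablePol (pol : (t : ℕ) → (Fin t → Traj S A H) → Policy S A H) (K : ℕ) : Prop :=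
  ∀ k < K, ∀ h, Measurable fun p : (Fin k → Traj S A H) × S => pol k p.1 h p.2

namespace MeasurablePol

lemma measurable (hpol : MeasurablePol pol K) (hk : k < K) (D : Fin k → Traj S A H) (h : Fin H) :
    Measurable (pol k D h) :=
  (hpol k hk h).comp measurable_prodMk_left

lemma isProbabilityMeasure_trajLaw (hpol : MeasurablePol pol K) (hk : k < K)
    (D : Fin k → Traj S A H) : IsProbabilityMeasure (trajLaw H M.P (pol k D) M.s₁) :=
  Golf.isProbabilityMeasure_trajLaw (hpol.measurable hk D) _

lemma measurable_trajLaw (hpol : MeasurablePol pol K) (hk : k < K) :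
    Measurable fun D : Fin k → Traj S A H => trajLaw H M.P (pol k D) M.s₁ :=
  measurable_trajLaw_param (hpol k hk) _

lemma measurable_map_snoc (hpol : MeasurablePol pol K) (hk : k < K) :
    Measurable fun D : Fin k → Traj S A H =>
      (trajLaw H M.P (pol k D) M.s₁).map (Fin.snoc (α := fun _ => Traj S A H) D) :=
  have := hpol.isProbabilityMeasure_trajLaw (M := M) hk
  measurable_map_of_measurable (F := fun D => Fin.snoc (α := fun _ => Traj S A H) D)
    (hpol.measurable_trajLaw hk) measurable_finSnoc

lemma isProbabilityMeasure_runLaw (hpol : MeasurablePol pol K) (hk : k ≤ K) :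
    IsProbabilityMeasure (M.runLaw pol k) := by
  induction k with
  | zero =>
    rw [runLaw]
    infer_instance
  | succ k ih =>
    have := ih (by omega)
    have (D : Fin k → Traj S A H) : IsProbabilityMeasure
        ((trajLaw H M.P (pol k D) M.s₁).map (Fin.snoc (α := fun _ => Traj S A H) D)) :=
      have := hpol.isProbabilityMeasure_trajLaw (M := M) hk D
      Measure.isProbabilityMeasure_map
        (measurable_finSnoc.comp measurable_prodMk_left).aemeasurable
    exact isProbabilityMeasure_bind _ (hpol.measurable_map_snoc hk)

lemma lintegral_runLaw_succ (hpol : MeasurablePol pol K) (hk : k < K)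
    {g : (Fin (k + 1) → Traj S A H) → ℝ≥0∞} (hg : Measurable g) :
    ∫⁻ D, g D ∂(M.runLaw pol (k + 1)) =
      ∫⁻ D, ∫⁻ τ, g (Fin.snoc D τ) ∂(trajLaw H M.P (pol k D) M.s₁) ∂(M.runLaw pol k) := by
  rw [runLaw, Measure.lintegral_bind (hpol.measurable_map_snoc hk).aemeasurable hg.aemeasurable]
  exact lintegral_congr fun D => lintegral_map hg (measurable_finSnoc.comp measurable_prodMk_left)

end MeasurablePol

/-- The data of the first `n` of `K` episodes. -/
def pre {X : Type*} (D : Fin K → X) (n : ℕ) (hn : n ≤ K) : Fin n → X :=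
  fun i => D (Fin.castLE hn i)

lemma measurable_pre {X : Type*} [MeasurableSpace X] (hn : n ≤ K) :
    Measurable fun D : Fin K → X => pre D n hn :=
  measurable_pi_iff.2 fun _ => measurable_pi_apply _

lemma pre_snoc {X : Type*} (hn : n ≤ k) (D : Fin k → X) (x : X) :
    pre (Fin.snoc D x : Fin (k + 1) → X) n (hn.trans k.le_succ) = pre D n hn :=
  funext fun i => Fin.snoc_castSucc (α := fun _ => X) x D (Fin.castLE hn i)

lemma lintegral_runLaw_pre (hpol : MeasurablePol pol K) (hn : n ≤ k) (hk : k ≤ K)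
    {g : (Fin n → Traj S A H) → ℝ≥0∞} (hg : Measurable g) :
    ∫⁻ D, g (pre D n hn) ∂(M.runLaw pol k) = ∫⁻ D, g D ∂(M.runLaw pol n) := by
  induction k, hn using Nat.le_induction with
  | base => rfl
  | succ k hnk ih =>
    rw [hpol.lintegral_runLaw_succ hk (g := fun D => g (pre D n (hnk.trans k.le_succ)))
      (hg.comp (measurable_pre _)), ← ih (by omega)]
    refine lintegral_congr fun D => ?_
    have := hpol.isProbabilityMeasure_trajLaw (M := M) hk D
    simp [pre_snoc hnk]

/-- The sum of `ψ_t(D_0, …, D_{t-1}; D_t)` over the episodes. -/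
def cumSum {X : Type*} (ψ : (t : ℕ) → (Fin t → X) → X → ℝ) (D : Fin n → X) : ℝ :=
  ∑ t : Fin n, ψ t (pre D t t.isLt.le) (D t)

lemma cumSum_snoc {X : Type*} (ψ : (t : ℕ) → (Fin t → X) → X → ℝ) (D : Fin n → X) (x : X) :
    cumSum ψ (Fin.snoc D x : Fin (n + 1) → X) = cumSum ψ D + ψ n D x := by
  rw [cumSum, Fin.sum_univ_castSucc, Fin.snoc_last]
  congr 1
  · exact Finset.sum_congr rfl fun t _ => congrArg₂ (ψ t) (pre_snoc t.isLt.le D x)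
      (Fin.snoc_castSucc (α := fun _ => X) x D t)
  · exact congrArg (ψ n · x) (pre_snoc le_rfl D x)

/-- The increments `ψ_t` are measurable and satisfy `E[exp ψ_t ∣ D_0, …, D_{t-1}] ≤ 1`, so that
`exp (cumSum ψ)` is a supermartingale under `M.runLaw pol`. -/
structure IsExpSupermartingale (M : MDP S A H)
    (pol : (t : ℕ) → (Fin t → Traj S A H) → Policy S A H) (K : ℕ)
    (ψ : (t : ℕ) → (Fin t → Traj S A H) → Traj S A H → ℝ) : Prop where
  measurable : ∀ t < K, Measurable fun p : (Fin t → Traj S A H) × Traj S A H => ψ t p.1 p.2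
  lintegral_exp_le : ∀ t < K, ∀ D,
    ∫⁻ τ, ENNReal.ofReal (Real.exp (ψ t D τ)) ∂(trajLaw H M.P (pol t D) M.s₁) ≤ 1

namespace IsExpSupermartingale

variable {ψ : (t : ℕ) → (Fin t → Traj S A H) → Traj S A H → ℝ}

lemma measurable_exp_cumSum (hψ : IsExpSupermartingale M pol K ψ) (hn : n ≤ K) :
    Measurable fun D : Fin n → Traj S A H => ENNReal.ofReal (Real.exp (cumSum ψ D)) := by
  have hsum : Measurable fun D : Fin n → Traj S A H => cumSum ψ D :=
    Finset.measurable_sum _ fun t _ => (hψ.measurable t (t.isLt.trans_le hn)).comp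
      ((measurable_pre t.isLt.le).prodMk (measurable_pi_apply t))
  exact (Real.measurable_exp.comp hsum).ennreal_ofReal

lemma lintegral_exp_cumSum_le (hψ : IsExpSupermartingale M pol K ψ) (hpol : MeasurablePol pol K)
    (hn : n ≤ K) : ∫⁻ D, ENNReal.ofReal (Real.exp (cumSum ψ D)) ∂(M.runLaw pol n) ≤ 1 := by
  induction n with
  | zero =>
    have := hpol.isProbabilityMeasure_runLaw (M := M) hn
    simp [cumSum]
  | succ n ih =>
    rw [hpol.lintegral_runLaw_succ hn (hψ.measurable_exp_cumSum hn)]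
    refine le_trans (lintegral_mono fun D => ?_) (ih (by omega))
    simp only [cumSum_snoc, Real.exp_add, ENNReal.ofReal_mul (Real.exp_nonneg _)]
    have hmeas : Measurable fun τ => ENNReal.ofReal (Real.exp (ψ n D τ)) :=
      (Real.measurable_exp.comp ((hψ.measurable n hn).comp measurable_prodMk_left)).ennreal_ofReal
    rw [lintegral_const_mul _ hmeas]
    exact mul_le_of_le_one_right zero_le (hψ.lintegral_exp_le n hn D)

lemma runLaw_le_cumSum (hψ : IsExpSupermartingale M pol K ψ) (hpol : MeasurablePol pol K)
    (hn : n ≤ K) (L : ℝ) :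
    M.runLaw pol K {D | L ≤ cumSum ψ (pre D n hn)} ≤ ENNReal.ofReal (Real.exp (-L)) := by
  have hmeas := hψ.measurable_exp_cumSum hn
  calc M.runLaw pol K {D | L ≤ cumSum ψ (pre D n hn)}
      ≤ M.runLaw pol K {D | ENNReal.ofReal (Real.exp L) ≤
          ENNReal.ofReal (Real.exp (cumSum ψ (pre D n hn)))} :=
        measure_mono fun D hD => ENNReal.ofReal_le_ofReal (Real.exp_le_exp.2 hD)
    _ ≤ (∫⁻ D, ENNReal.ofReal (Real.exp (cumSum ψ (pre D n hn))) ∂(M.runLaw pol K)) /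
          ENNReal.ofReal (Real.exp L) :=
        meas_ge_le_lintegral_div (hmeas.comp (measurable_pre hn)).aemeasurable
          (by simp [Real.exp_pos]) ENNReal.ofReal_ne_top
    _ ≤ 1 / ENNReal.ofReal (Real.exp L) := by
        rw [lintegral_runLaw_pre hpol hn le_rfl hmeas]
        gcongr
        exact hψ.lintegral_exp_cumSum_le hpol hn
    _ = ENNReal.ofReal (Real.exp (-L)) := by
        rw [one_div, Real.exp_neg, ENNReal.ofReal_inv_of_pos (Real.exp_pos L)]

end IsExpSupermartingale

lemma one_sub_le_runLaw_forall_cumSum_lt (hpol : MeasurablePol pol K) {ι : Type*} [Fintype ι]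
    {n : ι → ℕ} (hn : ∀ i, n i ≤ K)
    {ψ : ι → (t : ℕ) → (Fin t → Traj S A H) → Traj S A H → ℝ}
    (hψ : ∀ i, IsExpSupermartingale M pol K (ψ i)) (L : ℝ) :
    ENNReal.ofReal (1 - Fintype.card ι * Real.exp (-L)) ≤
      M.runLaw pol K {D | ∀ i, cumSum (ψ i) (pre D (n i) (hn i)) < L} := by
  have := hpol.isProbabilityMeasure_runLaw (M := M) le_rfl
  set good := {D : Fin K → Traj S A H | ∀ i, cumSum (ψ i) (pre D (n i) (hn i)) < L} with hgood
  have hbad : M.runLaw pol K goodᶜ ≤ ENNReal.ofReal (Fintype.card ι * Real.exp (-L)) := by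
    calc M.runLaw pol K goodᶜ
        = M.runLaw pol K (⋃ i, {D | L ≤ cumSum (ψ i) (pre D (n i) (hn i))}) := by
          congr 1
          ext D
          simp [hgood]
      _ ≤ ∑ i, M.runLaw pol K {D | L ≤ cumSum (ψ i) (pre D (n i) (hn i))} :=
          measure_iUnion_fintype_le _ _
      _ ≤ ∑ _i : ι, ENNReal.ofReal (Real.exp (-L)) :=
          Finset.sum_le_sum fun i _ => (hψ i).runLaw_le_cumSum hpol (hn i) L
      _ = ENNReal.ofReal (Fintype.card ι * Real.exp (-L)) := by
          rw [Finset.sum_const, Finset.card_univ, nsmul_eq_mul,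
            ENNReal.ofReal_mul (by positivity), ENNReal.ofReal_natCast]
  rw [ENNReal.ofReal_sub _ (by positivity), ENNReal.ofReal_one, tsub_le_iff_right]
  calc (1 : ℝ≥0∞) = M.runLaw pol K (good ∪ goodᶜ) := by simp
    _ ≤ M.runLaw pol K good + M.runLaw pol K goodᶜ := measure_union_le _ _
    _ ≤ _ := by gcongr

end Runs

end MDP

section ExponentialMoments

variable {α : Type*} [MeasurableSpace α] {μ : Measure α}

lemma lintegral_exp_add (c : ℝ) (f : α → ℝ) :
    ∫⁻ a, ENNReal.ofReal (Real.exp (c + f a)) ∂μ =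
      ENNReal.ofReal (Real.exp c) * ∫⁻ a, ENNReal.ofReal (Real.exp (f a)) ∂μ := by
  simp_rw [Real.exp_add, ENNReal.ofReal_mul (Real.exp_nonneg c)]
  exact lintegral_const_mul' _ _ ENNReal.ofReal_ne_top

lemma lintegral_exp_add_le {f : α → ℝ} {b : ℝ}
    (hf : ∫⁻ a, ENNReal.ofReal (Real.exp (f a)) ∂μ ≤ ENNReal.ofReal (Real.exp b)) (c : ℝ) :
    ∫⁻ a, ENNReal.ofReal (Real.exp (c + f a)) ∂μ ≤ ENNReal.ofReal (Real.exp (c + b)) := by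
  rw [lintegral_exp_add, Real.exp_add, ENNReal.ofReal_mul (Real.exp_nonneg c)]
  gcongr

variable [IsProbabilityMeasure μ]

lemma lintegral_exp_mul_sub_integral_le {v : α → ℝ} (hv : Measurable v) {a b : ℝ}
    (hab : ∀ x, v x ∈ Set.Icc a b) (t : ℝ) :
    ∫⁻ x, ENNReal.ofReal (Real.exp (t * (v x - ∫ y, v y ∂μ))) ∂μ ≤
      ENNReal.ofReal (Real.exp (t ^ 2 * (b - a) ^ 2 / 8)) := by
  have hsub := hasSubgaussianMGF_of_mem_Icc (μ := μ) hv.aemeasurable (.of_forall hab)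
  rw [← ofReal_integral_eq_lintegral_ofReal (hsub.integrable_exp_mul t)
    (.of_forall fun x => Real.exp_nonneg _)]
  refine ENNReal.ofReal_le_ofReal ((hsub.mgf_le t).trans (Real.exp_le_exp.2 (le_of_eq ?_)))
  simp only [NNReal.coe_pow, NNReal.coe_div, coe_nnnorm, NNReal.coe_ofNat, div_pow,
    Real.norm_eq_abs, sq_abs]
  ring

lemma lintegral_exp_neg_sq_sub_sq_le {v : α → ℝ} (hv : UnitMeasurable v) (c : ℝ) :
    ∫⁻ x, ENNReal.ofReal (Real.exp (-((c - v x) ^ 2 - ((∫ y, v y ∂μ) - v x) ^ 2))) ∂μ ≤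
      ENNReal.ofReal (Real.exp (-((c - ∫ y, v y ∂μ) ^ 2 / 2))) := by
  set m := ∫ y, v y ∂μ with hm
  have hlin (x : α) : -((c - v x) ^ 2 - (m - v x) ^ 2) =
      -(c - m) ^ 2 + 2 * (c - m) * (v x - m) := by ring
  have hhoeffding := lintegral_exp_mul_sub_integral_le (μ := μ) hv.1 hv.2 (2 * (c - m))
  rw [← hm] at hhoeffding
  simp_rw [hlin]
  refine (lintegral_exp_add_le hhoeffding _).trans_eq ?_
  congr 2
  ring

lemma exp_neg_le_one_sub_half {u : ℝ} (h0 : 0 ≤ u) (h1 : u ≤ 1) : Real.exp (-u) ≤ 1 - u / 2 := by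
  rw [Real.exp_neg, inv_le_iff_one_le_mul₀ (Real.exp_pos u)]
  nlinarith [Real.add_one_le_exp u]

lemma lintegral_exp_neg_le {φ : α → ℝ} (hφ : UnitMeasurable φ) :
    ∫⁻ x, ENNReal.ofReal (Real.exp (-φ x)) ∂μ ≤
      ENNReal.ofReal (Real.exp (-((∫ x, φ x ∂μ) / 2))) := by
  have hint : Integrable (fun x => φ x / 2) μ := (hφ.bdd.integrable μ).div_const 2
  calc ∫⁻ x, ENNReal.ofReal (Real.exp (-φ x)) ∂μ
      ≤ ∫⁻ x, ENNReal.ofReal (1 - φ x / 2) ∂μ := lintegral_mono fun x =>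
        ENNReal.ofReal_le_ofReal (exp_neg_le_one_sub_half (hφ.2 x).1 (hφ.2 x).2)
    _ = ENNReal.ofReal (∫ x, (1 - φ x / 2) ∂μ) :=
        (ofReal_integral_eq_lintegral_ofReal ((integrable_const _).sub hint)
          (.of_forall fun x => show 0 ≤ 1 - φ x / 2 by linarith [(hφ.2 x).2])).symm
    _ = ENNReal.ofReal (-((∫ x, φ x ∂μ) / 2) + 1) := by
        rw [integral_sub (integrable_const _) hint, integral_div, integral_const, probReal_univ,
          one_smul, sub_eq_neg_add]
    _ ≤ ENNReal.ofReal (Real.exp (-((∫ x, φ x ∂μ) / 2))) :=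
        ENNReal.ofReal_le_ofReal (Real.add_one_le_exp _)

end ExponentialMoments

namespace MDP

variable {S A : Type*} [MeasurableSpace S] [MeasurableSpace A] {H : ℕ} {M : MDP S A H}

/-- The excess, on one observation, of the squared loss of `u` over that of the Bellman backup of
`ζ`. -/
def excessLoss (M : MDP S A H) (h : Fin H) (u ζ : S × A → ℝ) (y : (S × A) × S) : ℝ :=
  (u y.1 - M.r h y.1 - maxVal ζ y.2) ^ 2 - (M.bellman h ζ y.1 - M.r h y.1 - maxVal ζ y.2) ^ 2

section Supermartingales

variable {h : Fin H} {u ζ : S × A → ℝ} {π : Policy S A H}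
  {pol : (t : ℕ) → (Fin t → Traj S A H) → Policy S A H} {K : ℕ}

lemma measurable_excessLoss (hu : Measurable u) (hζ : Measurable (maxVal ζ))
    (hT : Measurable (M.bellman h ζ)) : Measurable (M.excessLoss h u ζ) := by
  have hr : Measurable fun y : (S × A) × S => M.r h y.1 := (M.measurable_r h).comp measurable_fst
  have hv : Measurable fun y : (S × A) × S => maxVal ζ y.2 := hζ.comp measurable_snd
  exact ((((hu.comp measurable_fst).sub hr).sub hv).pow_const 2).sub
    ((((hT.comp measurable_fst).sub hr).sub hv).pow_const 2)

lemma measurable_bellmanErr (hu : Measurable u) (hT : Measurable (M.bellman h ζ)) :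
    Measurable (M.bellmanErr h u ζ) :=
  hu.sub hT

lemma lintegral_exp_neg_excessLoss_le (h : Fin H) (u : S × A → ℝ)
    (hζ : UnitMeasurable (maxVal ζ)) (x : S × A) :
    ∫⁻ s', ENNReal.ofReal (Real.exp (-M.excessLoss h u ζ (x, s'))) ∂(M.P h x) ≤
      ENNReal.ofReal (Real.exp (-(M.bellmanErr h u ζ x ^ 2 / 2))) := by
  convert lintegral_exp_neg_sq_sub_sq_le (μ := M.P h x) hζ (u x - M.r h x) using 7
  · rw [excessLoss, bellman_apply]
    ring
  · rw [bellmanErr, bellman_apply]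
    ring

lemma lintegral_exp_empirical_le (hπ : ∀ h, Measurable (π h)) (hu : UnitMeasurable u)
    (hζ : UnitMeasurable (maxVal ζ)) (hT : UnitMeasurable (M.bellman h ζ)) :
    ∫⁻ τ, ENNReal.ofReal (Real.exp (M.bellmanErr h u ζ (τ h).1 ^ 2 / 4 - M.excessLoss h u ζ (τ h)))
      ∂(trajLaw H M.P π M.s₁) ≤ 1 := by
  have := isProbabilityMeasure_trajLaw (P := M.P) hπ M.s₁
  have hmeas : Measurable fun y : (S × A) × S => ENNReal.ofReal (Real.exp
      (M.bellmanErr h u ζ y.1 ^ 2 / 4 - M.excessLoss h u ζ y)) := by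
    have herr := measurable_bellmanErr hu.1 hT.1
    have hexc := measurable_excessLoss hu.1 hζ.1 hT.1
    fun_prop
  rw [lintegral_trajLaw_markov hπ M.s₁ h hmeas]
  refine (lintegral_mono (g := fun _ => 1) fun τ => ?_).trans (by simp)
  simp only [sub_eq_add_neg]
  refine (lintegral_exp_add_le (lintegral_exp_neg_excessLoss_le h u hζ (τ h).1) _).trans ?_
  rw [ENNReal.ofReal_le_one, Real.exp_le_one_iff]
  nlinarith [sq_nonneg (M.bellmanErr h u ζ (τ h).1)]

lemma abs_bellmanErr_le_one (hu : UnitMeasurable u) (hT : UnitMeasurable (M.bellman h ζ))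
    (x : S × A) : |M.bellmanErr h u ζ x| ≤ 1 :=
  abs_sub_le_of_nonneg_of_le (hu.2 x).1 (hu.2 x).2 (hT.2 x).1 (hT.2 x).2

lemma lintegral_exp_population_le (hπ : ∀ h, Measurable (π h)) (hu : UnitMeasurable u)
    (hζ : UnitMeasurable (maxVal ζ)) (hT : UnitMeasurable (M.bellman h ζ)) :
    ∫⁻ τ, ENNReal.ofReal (Real.exp ((∫ x, M.bellmanErr h u ζ x ^ 2 ∂(M.occ π h)) / 4 -
      M.excessLoss h u ζ (τ h))) ∂(trajLaw H M.P π M.s₁) ≤ 1 := by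
  have := isProbabilityMeasure_trajLaw (P := M.P) hπ M.s₁
  have herr := measurable_bellmanErr hu.1 hT.1
  have hunit : UnitMeasurable fun τ : Traj S A H => M.bellmanErr h u ζ (τ h).1 ^ 2 / 2 :=
    ⟨((herr.comp (measurable_visit h)).pow_const 2).div_const 2, fun τ => ⟨by positivity, by
      linarith [(sq_le_one_iff_abs_le_one _).2 (abs_bellmanErr_le_one hu hT (τ h).1)]⟩⟩
  have hmeas : Measurable fun y => ENNReal.ofReal (Real.exp (-M.excessLoss h u ζ y)) :=
    (Real.measurable_exp.comp (measurable_excessLoss hu.1 hζ.1 hT.1).neg).ennreal_ofReal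
  have hocc : ∫ τ, M.bellmanErr h u ζ (τ h).1 ^ 2 / 2 ∂(trajLaw H M.P π M.s₁) =
      (∫ x, M.bellmanErr h u ζ x ^ 2 ∂(M.occ π h)) / 2 := by
    rw [integral_div, integral_occ π h (herr.pow_const 2)]
  have hneg : ∫⁻ τ, ENNReal.ofReal (Real.exp (-M.excessLoss h u ζ (τ h)))
      ∂(trajLaw H M.P π M.s₁) ≤
        ENNReal.ofReal (Real.exp (-((∫ x, M.bellmanErr h u ζ x ^ 2 ∂(M.occ π h)) / 4))) := by
    rw [lintegral_trajLaw_markov hπ M.s₁ h hmeas]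
    calc _ ≤ ∫⁻ τ, ENNReal.ofReal (Real.exp (-(M.bellmanErr h u ζ (τ h).1 ^ 2 / 2)))
          ∂(trajLaw H M.P π M.s₁) :=
          lintegral_mono fun τ => lintegral_exp_neg_excessLoss_le h u hζ (τ h).1
      _ ≤ _ := lintegral_exp_neg_le hunit
      _ = _ := by rw [hocc, div_div, show (2 : ℝ) * 2 = 4 by norm_num]
  simp only [sub_eq_add_neg]
  refine (lintegral_exp_add_le hneg _).trans_eq ?_
  rw [add_neg_cancel, Real.exp_zero, ENNReal.ofReal_one]

lemma lintegral_exp_deviation_le (hπ : ∀ h, Measurable (π h)) (h : Fin H)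
    {φ : S × A → ℝ} (hφ : Measurable φ) (hφ1 : ∀ x, |φ x| ≤ 1) (l : ℝ) :
    ∫⁻ τ, ENNReal.ofReal (Real.exp (l * ((∫ x, φ x ∂(M.occ π h)) - φ (τ h).1) - l ^ 2 / 2))
      ∂(trajLaw H M.P π M.s₁) ≤ 1 := by
  have := isProbabilityMeasure_trajLaw (P := M.P) hπ M.s₁
  have hhoeffding := lintegral_exp_mul_sub_integral_le (μ := trajLaw H M.P π M.s₁)
    (hφ.comp (measurable_visit h)) (fun τ => abs_le.1 (hφ1 (τ h).1)) (-l)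
  simp only [Function.comp_apply, ← integral_occ π h hφ] at hhoeffding
  have hsplit (y : ℝ) : l * ((∫ x, φ x ∂(M.occ π h)) - y) - l ^ 2 / 2 =
      -(l ^ 2 / 2) + -l * (y - ∫ x, φ x ∂(M.occ π h)) := by ring
  simp_rw [hsplit]
  refine (lintegral_exp_add_le hhoeffding _).trans_eq ?_
  norm_num
  ring_nf

lemma measurable_integral_occ (hpol : MeasurablePol pol K) {t : ℕ} (ht : t < K) (h : Fin H)
    {φ : (Fin t → Traj S A H) → S × A → ℝ}
    (hφ : Measurable fun p : (Fin t → Traj S A H) × (S × A) => φ p.1 p.2) :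
    Measurable fun D => ∫ x, φ D x ∂(M.occ (pol t D) h) := by
  have := hpol.isProbabilityMeasure_trajLaw (M := M) ht
  have hocc (D : Fin t → Traj S A H) : ∫ x, φ D x ∂(M.occ (pol t D) h) =
      ∫ τ, φ D (τ h).1 ∂(trajLaw H M.P (pol t D) M.s₁) :=
    integral_occ (pol t D) h (hφ.comp measurable_prodMk_left)
  simp_rw [hocc]
  exact measurable_integral_of_measurable (hpol.measurable_trajLaw ht)
    (hφ.comp (measurable_fst.prodMk ((measurable_visit h).comp measurable_snd)))

lemma isExpSupermartingale_empirical (hpol : MeasurablePol pol K) (hu : UnitMeasurable u)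
    (hζ : UnitMeasurable (maxVal ζ)) (hT : UnitMeasurable (M.bellman h ζ)) :
    IsExpSupermartingale M pol K fun _ _ τ =>
      M.bellmanErr h u ζ (τ h).1 ^ 2 / 4 - M.excessLoss h u ζ (τ h) where
  measurable _ _ := by
    have herr := measurable_bellmanErr hu.1 hT.1
    have hexc := measurable_excessLoss hu.1 hζ.1 hT.1
    fun_prop
  lintegral_exp_le _ ht D := lintegral_exp_empirical_le (hpol.measurable ht D) hu hζ hT

lemma isExpSupermartingale_population (hpol : MeasurablePol pol K) (hu : UnitMeasurable u)
    (hζ : UnitMeasurable (maxVal ζ)) (hT : UnitMeasurable (M.bellman h ζ)) :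
    IsExpSupermartingale M pol K fun t D τ =>
      (∫ x, M.bellmanErr h u ζ x ^ 2 ∂(M.occ (pol t D) h)) / 4 - M.excessLoss h u ζ (τ h) where
  measurable _ ht := by
    have herr := measurable_bellmanErr hu.1 hT.1
    have hexc := measurable_excessLoss hu.1 hζ.1 hT.1
    have hocc := measurable_integral_occ (M := M) hpol ht h
      (φ := fun _ x => M.bellmanErr h u ζ x ^ 2) (by fun_prop)
    exact ((hocc.comp measurable_fst).div_const 4).sub (by fun_prop)
  lintegral_exp_le _ ht D := lintegral_exp_population_le (hpol.measurable ht D) hu hζ hT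

lemma isExpSupermartingale_deviation (hpol : MeasurablePol pol K) (h : Fin H)
    {φ : (t : ℕ) → (Fin t → Traj S A H) → S × A → ℝ}
    (hφ : ∀ t < K, Measurable fun p : (Fin t → Traj S A H) × (S × A) => φ t p.1 p.2)
    (hφ1 : ∀ t < K, ∀ D x, |φ t D x| ≤ 1) (l : ℝ) :
    IsExpSupermartingale M pol K fun t D τ =>
      l * ((∫ x, φ t D x ∂(M.occ (pol t D) h)) - φ t D (τ h).1) - l ^ 2 / 2 where
  measurable t ht := ((((measurable_integral_occ hpol ht h (hφ t ht)).comp measurable_fst).sub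
    ((hφ t ht).comp (measurable_fst.prodMk ((measurable_visit h).comp measurable_snd)))).const_mul
      l).sub_const _
  lintegral_exp_le t ht D := lintegral_exp_deviation_le (hpol.measurable ht D) h
    ((hφ t ht).comp measurable_prodMk_left) (hφ1 t ht D) l

end Supermartingales

end MDP

section Eluder

-- Going through the indices in order, each one joins a class of least past weight.
lemma exists_forall_sum_filter_eq_le {ι : Type*} [LinearOrder ι] {w : ι → ι → ℝ} {B e : ℝ} {m : ℕ}
    (hB : B < (m + 1) * e) (s : Finset ι) (hsum : ∀ t ∈ s, ∑ i ∈ s with i < t, w t i ≤ B) :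
    ∃ c : ι → Fin (m + 1), ∀ t ∈ s, ∑ i ∈ s with i < t ∧ c i = c t, w t i ≤ e := by
  induction s using Finset.induction_on_max with
  | empty => exact ⟨0, by simp⟩
  | insert a s hlt ih =>
    have hna : a ∉ s := fun ha => (hlt a ha).false
    have hpast (t : ι) (ht : t ∈ s) (q : ι → Prop) [DecidablePred q] :
        {i ∈ insert a s | i < t ∧ q i} = {i ∈ s | i < t ∧ q i} := by
      rw [Finset.filter_insert, if_neg fun h => (h.1.trans (hlt t ht)).false]
    obtain ⟨c, hc⟩ := ih fun t ht => by
      have hpast' := hpast t ht fun _ => True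
      simp only [and_true] at hpast'
      exact hpast' ▸ hsum t (Finset.mem_insert_of_mem ht)
    have htotal : ∑ i ∈ s, w a i ≤ B := by
      simpa [Finset.filter_insert, Finset.filter_true_of_mem hlt]
        using hsum a (Finset.mem_insert_self a s)
    obtain ⟨j, hj⟩ : ∃ j : Fin (m + 1), ∑ i ∈ s with c i = j, w a i ≤ e := by
      by_contra! hcon
      have hlow := Finset.sum_le_sum fun (j : Fin (m + 1)) (_ : j ∈ Finset.univ) => (hcon j).le
      rw [Finset.sum_fiberwise] at hlow
      simp only [Finset.sum_const, Finset.card_univ, Fintype.card_fin, nsmul_eq_mul] at hlow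
      push_cast at hlow
      linarith
    have hupd (i : ι) (hi : i ∈ s) : Function.update c a j i = c i :=
      Function.update_of_ne (ne_of_mem_of_not_mem hi hna) _ _
    refine ⟨Function.update c a j, fun t ht => ?_⟩
    rcases Finset.mem_insert.1 ht with rfl | ht
    · convert hj using 1
      refine Finset.sum_congr ?_ fun _ _ => rfl
      rw [Finset.filter_insert, if_neg fun h => h.1.false]
      exact Finset.filter_congr fun i hi => by simp [hupd i hi, hlt i hi]
    · rw [hpast t ht, hupd t ht]
      convert hc t ht using 1
      refine Finset.sum_congr (Finset.filter_congr fun i hi => ?_) fun _ _ => rfl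
      rw [hupd i hi]

variable {ι : Type*} [LinearOrder ι] {X : Type*} [MeasurableSpace X] {Φ : Set (X → ℝ)}
  {Ps : Set (Measure X)} {φ : ι → X → ℝ} {μ : ι → Measure X} {s : Finset ι} {d : ℕ}

lemma card_le_of_deDim_le {ε ε' : ℝ} (hd : deDim Φ Ps ε ≤ d) (hε : ε ≤ ε') (hε0 : 0 ≤ ε')
    (hφ : ∀ t ∈ s, φ t ∈ Φ) (hμ : ∀ t ∈ s, μ t ∈ Ps)
    (hlarge : ∀ t ∈ s, ε' < |∫ x, φ t x ∂(μ t)|)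
    (hsmall : ∀ t ∈ s, ∑ i ∈ s with i < t, (∫ x, φ t x ∂(μ i)) ^ 2 ≤ ε' ^ 2) :
    s.card ≤ d := by
  set e := s.orderEmbOfFin rfl
  have he (i : Fin s.card) : e i ∈ s := s.orderEmbOfFin_mem rfl i
  have hindep (i : Fin s.card) :
      IsIndepOf Φ ε' (μ (e i)) fun j : Fin i => μ (e (Fin.castLE i.isLt.le j)) := by
    refine ⟨φ (e i), hφ _ (he i), Real.sqrt_le_iff.2 ⟨hε0, le_trans ?_ (hsmall _ (he i))⟩,
      hlarge _ (he i)⟩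
    have hinj : Function.Injective fun j : Fin i => e (Fin.castLE i.isLt.le j) :=
      e.injective.comp (Fin.castLE_injective _)
    rw [← Finset.sum_image (f := fun t => (∫ x, φ (e i) x ∂(μ t)) ^ 2) hinj.injOn]
    refine Finset.sum_le_sum_of_subset_of_nonneg (fun t ht => ?_) fun _ _ _ => sq_nonneg _
    obtain ⟨j, -, rfl⟩ := Finset.mem_image.1 ht
    exact Finset.mem_filter.2 ⟨he _, e.lt_iff_lt.2 (Fin.lt_def.2 j.2)⟩
  have hcard : (s.card : ℕ∞) ≤ deDim Φ Ps ε :=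
    le_iSup₂_of_le s.card ⟨fun i => μ (e i), fun i => hμ _ (he i), ε', hε, hindep⟩ le_rfl
  exact_mod_cast hcard.trans hd

lemma card_filter_lt_abs_integral_le {ω : ℝ} (hd : deDim Φ Ps ω ≤ d) (hφ : ∀ t ∈ s, φ t ∈ Φ)
    (hμ : ∀ t ∈ s, μ t ∈ Ps) {B : ℝ} (hB0 : 0 ≤ B)
    (hB : ∀ t ∈ s, ∑ i ∈ s with i < t, (∫ x, φ t x ∂(μ i)) ^ 2 ≤ B)
    {ε : ℝ} (hε : ω ≤ ε) (hε0 : 0 < ε) :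
    (Finset.card {t ∈ s | ε < |∫ x, φ t x ∂(μ t)|} : ℝ) ≤ (B / ε ^ 2 + 1) * d := by
  set m := ⌊B / ε ^ 2⌋₊
  set l := {t ∈ s | ε < |∫ x, φ t x ∂(μ t)|}
  have hls : l ⊆ s := Finset.filter_subset _ _
  have hBm : B < (m + 1) * ε ^ 2 := (div_lt_iff₀ (by positivity)).1 (Nat.lt_floor_add_one _)
  obtain ⟨c, hc⟩ := exists_forall_sum_filter_eq_le hBm l fun t ht =>
    (Finset.sum_le_sum_of_subset_of_nonneg (Finset.filter_subset_filter _ hls)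
      fun _ _ _ => sq_nonneg _).trans (hB t (hls ht))
  have hbucket (j : Fin (m + 1)) : Finset.card {t ∈ l | c t = j} ≤ d := by
    refine card_le_of_deDim_le hd hε hε0.le
      (fun t ht => hφ t (hls (Finset.mem_of_mem_filter t ht)))
      (fun t ht => hμ t (hls (Finset.mem_of_mem_filter t ht)))
      (fun t ht => (Finset.mem_filter.1 (Finset.mem_of_mem_filter t ht)).2) fun t ht => ?_
    obtain ⟨htl, rfl⟩ := Finset.mem_filter.1 ht
    rw [Finset.filter_filter]
    simpa only [and_comm] using hc t htl
  have hcard : l.card ≤ (m + 1) * d := by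
    rw [Finset.card_eq_sum_card_fiberwise (f := c) (t := Finset.univ) fun _ _ => by simp]
    exact (Finset.sum_le_sum fun j _ => hbucket j).trans (by simp)
  calc (l.card : ℝ) ≤ (m + 1) * d := by exact_mod_cast hcard
    _ ≤ (B / ε ^ 2 + 1) * d := by
      gcongr
      exact Nat.floor_le (by positivity)

lemma exists_le_of_card_filter_lt_le {ι : Type*} {a : ι → ℝ} {s : Finset ι} {ω B : ℝ} {d m : ℕ}
    (hω : 0 < ω) (hB : 0 ≤ B)
    (hcard : ∀ ε, ω ≤ ε → (Finset.card {t ∈ s | ε < a t} : ℝ) ≤ (B / ε ^ 2 + 1) * d)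
    (hs : s.card = d + (m + 1)) : ∃ t ∈ s, a t ≤ ω + √(d * B / (m + 1)) := by
  by_contra! hlt
  set y := √(d * B / (m + 1)) with hy
  have hy0 : 0 ≤ y := Real.sqrt_nonneg _
  have hyy : y ^ 2 * (m + 1) = d * B := by
    rw [hy, Real.sq_sqrt (by positivity), div_mul_cancel₀ _ (by positivity)]
  have hall := hcard (ω + y) (by linarith)
  rw [Finset.filter_true_of_mem hlt, hs, add_mul, one_mul, div_mul_eq_mul_div] at hall
  push_cast at hall
  have hm : (m + 1 : ℝ) * (ω + y) ^ 2 ≤ B * d := by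
    rw [← le_div_iff₀ (by positivity)]
    linarith
  nlinarith [mul_pos (show (0 : ℝ) < m + 1 by positivity) (show 0 < ω * (ω + 2 * y) by positivity)]

lemma two_mul_sqrt_add_sqrt_div_le {c x : ℝ} (hc : 0 ≤ c) (hx : 0 ≤ x) :
    2 * √(c * x) + √(c / (x + 1)) ≤ 2 * √(c * (x + 1)) := by
  have hx1 : 0 < x + 1 := by linarith
  rw [Real.sqrt_mul hc, Real.sqrt_mul hc, Real.sqrt_div hc]
  have hle : 2 * √x + 1 / √(x + 1) ≤ 2 * √(x + 1) := by
    have hpos := Real.sqrt_pos.2 hx1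
    rw [← le_sub_iff_add_le', div_le_iff₀ hpos]
    nlinarith [Real.sq_sqrt hx, Real.sq_sqrt hx1.le, sq_nonneg (√(x + 1) - √x)]
  calc _ = √c * (2 * √x + 1 / √(x + 1)) := by ring
    _ ≤ √c * (2 * √(x + 1)) := by gcongr
    _ = _ := by ring

lemma sum_le_of_card_eq_add {ι : Type*} {a : ι → ℝ} {s : Finset ι} {ω B : ℝ}
    {d m : ℕ} (ha : ∀ t ∈ s, a t ≤ 1) (hω : 0 < ω) (hB : 0 ≤ B)
    (hcard : ∀ ε, ω ≤ ε → (Finset.card {t ∈ s | ε < a t} : ℝ) ≤ (B / ε ^ 2 + 1) * d)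
    (hs : s.card = d + m) : ∑ t ∈ s, a t ≤ d + m * ω + 2 * √(d * B * m) := by
  classical
  induction m generalizing s with
  | zero =>
    have hle := Finset.sum_le_card_nsmul s a 1 ha
    simpa [hs] using hle
  | succ m ih =>
    obtain ⟨t, ht, hat⟩ := exists_le_of_card_filter_lt_le hω hB hcard hs
    have hsub : s.erase t ⊆ s := Finset.erase_subset t s
    have hrec := ih (fun i hi => ha i (hsub hi)) (fun ε hε => le_trans
      (by gcongr) (hcard ε hε)) (by rw [Finset.card_erase_of_mem ht, hs]; omega)
    have hsqrt := two_mul_sqrt_add_sqrt_div_le (c := d * B) (by positivity) m.cast_nonneg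
    rw [← Finset.sum_erase_add s a ht]
    push_cast
    linarith

lemma sum_le_of_card_filter_lt_le {ι : Type*} {a : ι → ℝ} {s : Finset ι} {ω B : ℝ} {d : ℕ}
    (ha : ∀ t ∈ s, a t ≤ 1) (hω : 0 < ω) (hB : 0 ≤ B)
    (hcard : ∀ ε, ω ≤ ε → (Finset.card {t ∈ s | ε < a t} : ℝ) ≤ (B / ε ^ 2 + 1) * d) :
    ∑ t ∈ s, a t ≤ s.card * ω + 2 * √(d * B * s.card) + √(d * s.card) := by
  rcases le_total s.card d with hsd | hds
  · have hsd' : (s.card : ℝ) ≤ d := by exact_mod_cast hsd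
    calc ∑ t ∈ s, a t ≤ s.card := by simpa using Finset.sum_le_card_nsmul s a 1 ha
      _ ≤ √(d * s.card) := Real.le_sqrt_of_sq_le (by rw [sq]; gcongr)
      _ ≤ _ := le_add_of_nonneg_left (by positivity)
  · obtain ⟨m, hm⟩ := Nat.exists_eq_add_of_le hds
    have hm' : (m : ℝ) ≤ s.card := by exact_mod_cast hm ▸ Nat.le_add_left m d
    have hds' : (d : ℝ) ≤ s.card := by exact_mod_cast hds
    calc ∑ t ∈ s, a t ≤ d + m * ω + 2 * √(d * B * m) := sum_le_of_card_eq_add ha hω hB hcard hm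
      _ ≤ √(d * s.card) + s.card * ω + 2 * √(d * B * s.card) := by
        gcongr
        exact Real.le_sqrt_of_sq_le (by rw [sq]; gcongr)
      _ = _ := by ring

lemma sq_integral_le_integral_sq {μ : Measure X} [IsProbabilityMeasure μ] {f : X → ℝ}
    (hf : BddMeasurable f) : (∫ x, f x ∂μ) ^ 2 ≤ ∫ x, f x ^ 2 ∂μ := by
  have hmem : MemLp f 2 μ := (memLp_two_iff_integrable_sq hf.1.aestronglyMeasurable).2
    (hf.sq.integrable μ)
  have hvar := variance_eq_sub hmem
  simp only [Pi.pow_apply] at hvar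
  linarith [variance_nonneg f μ]

lemma abs_integral_le_one {μ : Measure X} [IsProbabilityMeasure μ] {f : X → ℝ}
    (hf : ∀ x, |f x| ≤ 1) : |∫ x, f x ∂μ| ≤ 1 := by
  simpa using norm_integral_le_of_norm_le_const (μ := μ) (f := f) (C := 1) (.of_forall hf)

lemma sum_abs_integral_le [∀ t, IsProbabilityMeasure (μ t)] {ω : ℝ} (hω : 0 < ω)
    (hd : deDim Φ Ps ω ≤ d) (hφ : ∀ t ∈ s, φ t ∈ Φ) (hφm : ∀ t ∈ s, Measurable (φ t))
    (hφ1 : ∀ t ∈ s, ∀ x, |φ t x| ≤ 1) (hμ : ∀ t ∈ s, μ t ∈ Ps) {B : ℝ} (hB0 : 0 ≤ B)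
    (hB : ∀ t ∈ s, ∑ i ∈ s with i < t, ∫ x, φ t x ^ 2 ∂(μ i) ≤ B) :
    ∑ t ∈ s, |∫ x, φ t x ∂(μ t)| ≤ s.card * ω + 2 * √(d * B * s.card) + √(d * s.card) :=
  sum_le_of_card_filter_lt_le (fun t ht => abs_integral_le_one (hφ1 t ht)) hω hB0 fun _ hε =>
    card_filter_lt_abs_integral_le hd hφ hμ hB0 (fun t ht => (Finset.sum_le_sum fun _ _ =>
      sq_integral_le_integral_sq ⟨hφm t ht, 1, hφ1 t ht⟩).trans (hB t ht)) hε (hω.trans_le hε)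

end Eluder

section Nets

variable {S A : Type*} {H : ℕ} {V W : Set (QTuple S A H)}

/-- `Z` is a finite `ε`-net of the class `V` for the metric `max_h ‖f_h - g_h‖_∞`, with centres
in `V`. -/
structure IsNet (Z : Finset (QTuple S A H)) (V : Set (QTuple S A H)) (ε : ℝ) : Prop where
  mem : ∀ z ∈ Z, z ∈ V
  exists_abs_sub_le : ∀ f ∈ V, ∃ z ∈ Z, ∀ h x, |f h x - z h x| ≤ ε

lemma abs_sub_le_of_edist_le {f g : QTuple S A H} {ε : ℝ≥0}
    (hfg : edist (fun h => UniformFun.ofFun (f h)) (fun h => UniformFun.ofFun (g h)) ≤ ε)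
    (h : Fin H) (x : S × A) : |f h x - g h x| ≤ ε := by
  have hx := UniformFun.edist_le.1 ((edist_le_pi_edist _ _ h).trans hfg) x
  simp only [UniformFun.toFun_ofFun, edist_dist] at hx
  rw [← Real.dist_eq]
  exact (ENNReal.ofReal_le_iff_le_toReal ENNReal.coe_ne_top).1 hx

lemma exists_isNet_card_eq_coverNum {ε : ℝ≥0} (hV : coverNum V ε ≠ ⊤) :
    ∃ Z, IsNet Z V ε ∧ Z.card = coverNum V ε := by
  classical
  obtain ⟨C, hCV, hfin, hcov, hcard⟩ := Metric.exists_set_encard_eq_coveringNumber hV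
  lift C to Finset (Fin H → UniformFun (S × A) ℝ) using hfin
  obtain ⟨Z, hZV, rfl⟩ := Finset.subset_set_image_iff.1 hCV
  refine ⟨Z, ⟨hZV, fun f hf => ?_⟩, ?_⟩
  · obtain ⟨w, hw, hfw⟩ := hcov (Set.mem_image_of_mem _ hf)
    obtain ⟨z, hz, rfl⟩ := Finset.mem_image.1 hw
    exact ⟨z, hz, abs_sub_le_of_edist_le hfw⟩
  · rw [coverNum, ← hcard, Set.encard_coe_eq_coe_finsetCard, Finset.card_image_of_injective]
    exact fun f g hfg => funext fun h => congrFun hfg h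

lemma one_le_coverNum (hV : V.Nonempty) (ε : ℝ≥0) : 1 ≤ coverNum V ε :=
  Order.one_le_iff_pos.2 (Metric.coveringNumber_pos_iff.2 (hV.image _))

-- Centres of a subclass must lie in it, which costs a factor `2` in the radius.
lemma exists_isNet_of_subset {N K : ℕ} (hWV : W ⊆ V) (hN : coverNum V (1 / (K : ℝ≥0)) = N) :
    ∃ Z, IsNet Z W (2 / K) ∧ Z.card ≤ N := by
  have hW : coverNum W (2 / (K : ℝ≥0)) ≤ N := by
    rw [← hN, show 1 / (K : ℝ≥0) = 2 / K / 2 by rw [div_right_comm, div_self two_ne_zero]]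
    exact Metric.coveringNumber_subset_le (Set.image_mono hWV)
  obtain ⟨Z, hZ, hcard⟩ :=
    exists_isNet_card_eq_coverNum (ne_top_of_le_ne_top (ENat.natCast_ne_top N) hW)
  exact ⟨Z, by simpa using hZ, by exact_mod_cast hcard.trans_le hW⟩

end Nets

section Elementary

lemma sq_le_sq_add_of_abs_sub_le {a b B e : ℝ} (ha : |a| ≤ B) (hb : |b| ≤ B)
    (hab : |a - b| ≤ e) : a ^ 2 ≤ b ^ 2 + 2 * B * e := by
  have hsum : |a + b| ≤ 2 * B := (abs_add_le a b).trans (by linarith)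
  have hprod : (a - b) * (a + b) ≤ e * (2 * B) := (le_abs_self _).trans <| by
    rw [abs_mul]
    exact mul_le_mul hab hsum (abs_nonneg _) ((abs_nonneg _).trans hab)
  linarith

lemma mul_le_mul_add_of_abs_sub_le {a b x y e : ℝ} (hb : |b| ≤ 1) (hx : |x| ≤ 1)
    (hab : |a - b| ≤ e) (hxy : |x - y| ≤ e) : a * x ≤ b * y + 2 * e := by
  have hleft : (a - b) * x ≤ e * 1 := (le_abs_self _).trans <| by
    rw [abs_mul]
    exact mul_le_mul hab hx (abs_nonneg _) ((abs_nonneg _).trans hab)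
  have hright : b * (x - y) ≤ 1 * e := (le_abs_self _).trans <| by
    rw [abs_mul]
    exact mul_le_mul hb hxy (abs_nonneg _) zero_le_one
  linarith

lemma sum_le_sum_add_of_le_add_div {n K : ℕ} (hn : n ≤ K) {f g : Fin n → ℝ} {c : ℝ} (hc : 0 ≤ c)
    (hfg : ∀ t, f t ≤ g t + c / K) : ∑ t, f t ≤ ∑ t, g t + c := by
  have hfrac : (n : ℝ) / K ≤ 1 := div_le_one_of_le₀ (by exact_mod_cast hn) (by positivity)
  calc ∑ t, f t ≤ ∑ t, (g t + c / K) := Finset.sum_le_sum fun t _ => hfg t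
    _ = ∑ t, g t + c * (n / K) := by
      rw [Finset.sum_add_distrib, Finset.sum_const, Finset.card_univ, Fintype.card_fin,
        nsmul_eq_mul]
      ring
    _ ≤ ∑ t, g t + c := by gcongr; exact mul_le_of_le_one_right hc hfrac

lemma abs_integral_sub_integral_le {X : Type*} [MeasurableSpace X] {μ : Measure X}
    [IsProbabilityMeasure μ] {f g : X → ℝ} (hf : BddMeasurable f) (hg : BddMeasurable g) {ε : ℝ}
    (hfg : ∀ x, |f x - g x| ≤ ε) : |(∫ x, f x ∂μ) - ∫ x, g x ∂μ| ≤ ε := by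
  rw [← integral_sub (hf.integrable μ) (hg.integrable μ)]
  simpa using norm_integral_le_of_norm_le_const (f := fun x => f x - g x) (μ := μ) (.of_forall hfg)

end Elementary

section Discretisation

variable {S A : Type*} {H : ℕ}

lemma IsGreedyPolicy.abs_maxVal_entry_sub_le [MeasurableSpace S] [MeasurableSpace A]
    {f g : QTuple S A H} {π ρ : Policy S A H} (hf : IsGreedyPolicy f π) (hg : IsGreedyPolicy g ρ)
    {ε : ℝ} (hε : 0 ≤ ε) (hfg : ∀ h x, |f h x - g h x| ≤ ε) (j : ℕ) (s : S) :
    |maxVal (entry f j) s - maxVal (entry g j) s| ≤ ε := by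
  obtain hj | hj := lt_or_ge j H
  · rw [entry_of_lt _ hj, entry_of_lt _ hj, hf.maxVal_eq, hg.maxVal_eq, abs_le]
    have hπ := abs_le.1 (hfg ⟨j, hj⟩ (s, π ⟨j, hj⟩ s))
    have hρ := abs_le.1 (hfg ⟨j, hj⟩ (s, ρ ⟨j, hj⟩ s))
    constructor
    · linarith [hf.isMax ⟨j, hj⟩ s (ρ ⟨j, hj⟩ s)]
    · linarith [hg.isMax ⟨j, hj⟩ s (π ⟨j, hj⟩ s)]
  · rwa [entry_of_le _ hj, entry_of_le _ hj, sub_self, abs_zero]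

end Discretisation

section ConfidenceSets

variable {S A : Type*} [MeasurableSpace S] [MeasurableSpace A] {H : ℕ}

/-- The standing assumptions on the function classes: their members are measurable with values
in `[0, 1]`, those of `F` have greedy policies, and realizability and generalized completeness
hold. -/
structure Assumptions (M : MDP S A H) (F G : Fin H → Set (S × A → ℝ))
    (greedy : QTuple S A H → Policy S A H) : Prop where
  unitMeasurable_F : ∀ h, ∀ f ∈ F h, UnitMeasurable f
  unitMeasurable_G : ∀ h, ∀ g ∈ G h, UnitMeasurable g
  isGreedy : IsGreedy F greedy
  realizable : M.Realizable F
  complete : M.Complete F G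

variable {M : MDP S A H} {F G : Fin H → Set (S × A → ℝ)} {greedy : QTuple S A H → Policy S A H}
  {f g : QTuple S A H}

namespace MDP

lemma excessLoss_eq (M : MDP S A H) (h : Fin H) (u ζ : S × A → ℝ) (y : (S × A) × S) :
    M.excessLoss h u ζ y = M.bellmanErr h u ζ y.1 ^ 2 +
      2 * (M.bellmanErr h u ζ y.1 * (M.bellman h ζ y.1 - M.r h y.1 - maxVal ζ y.2)) := by
  rw [excessLoss, bellmanErr]
  ring

lemma loss_sub_loss_bellman (M : MDP S A H) {n : ℕ} (D : Fin n → Traj S A H) (h : Fin H)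
    (u ζ : S × A → ℝ) :
    M.loss D h u ζ - M.loss D h (M.bellman h ζ) ζ = ∑ t, M.excessLoss h u ζ (D t h) := by
  rw [loss, loss, ← Finset.sum_sub_distrib]
  rfl

lemma iInf_loss_le (M : MDP S A H) {n : ℕ} (D : Fin n → Traj S A H) (h : Fin H)
    (ζ : S × A → ℝ) {g : S × A → ℝ} (hg : g ∈ G h) : ⨅ g : G h, M.loss D h g.1 ζ ≤ M.loss D h g ζ :=
  ciInf_le (f := fun g : G h => M.loss D h g.1 ζ)
    ⟨0, Set.forall_mem_range.2 fun _ => Finset.sum_nonneg fun _ _ => sq_nonneg _⟩ ⟨g, hg⟩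

end MDP

namespace Assumptions

lemma isGreedyPolicy (hM : Assumptions M F G greedy) (hf : f ∈ prodClass F) :
    IsGreedyPolicy f (greedy f) :=
  hM.isGreedy.isGreedyPolicy hf

lemma unitMeasurable (hM : Assumptions M F G greedy) (hf : f ∈ prodClass F) (h : Fin H) :
    UnitMeasurable (f h) :=
  hM.unitMeasurable_F h _ (hf h trivial)

lemma unitMeasurable_maxVal (hM : Assumptions M F G greedy) (hf : f ∈ prodClass F) (j : ℕ) :
    UnitMeasurable (maxVal (entry f j)) :=
  (hM.isGreedyPolicy hf).unitMeasurable_maxVal_entry (hM.unitMeasurable hf) j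

lemma bellman_mem (hM : Assumptions M F G greedy) (hf : f ∈ prodClass F) (h : Fin H) :
    M.bellman h (entry f (h + 1)) ∈ G h :=
  hM.complete h ⟨_, entry_mem_classAt hf _, rfl⟩

lemma unitMeasurable_bellman (hM : Assumptions M F G greedy) (hf : f ∈ prodClass F) (h : Fin H) :
    UnitMeasurable (M.bellman h (entry f (h + 1))) :=
  hM.unitMeasurable_G h _ (hM.bellman_mem hf h)

lemma measurable_resid (hM : Assumptions M F G greedy) (hf : f ∈ prodClass F) (h : Fin H) :
    Measurable (M.resid f h) :=
  MDP.measurable_bellmanErr (hM.unitMeasurable hf h).1 (hM.unitMeasurable_bellman hf h).1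

lemma abs_resid_le_one (hM : Assumptions M F G greedy) (hf : f ∈ prodClass F) (h : Fin H)
    (x : S × A) : |M.resid f h x| ≤ 1 :=
  MDP.abs_bellmanErr_le_one (hM.unitMeasurable hf h) (hM.unitMeasurable_bellman hf h) x

lemma Qstar_mem (hM : Assumptions M F G greedy) : M.Qstar ∈ prodClass F :=
  fun h _ => hM.realizable h

lemma r_mem_Icc (hM : Assumptions M F G greedy) (h : Fin H) (x : S × A) :
    M.r h x ∈ Set.Icc (0 : ℝ) 1 :=
  ⟨M.r_nonneg h x, MDP.r_le_one (hM.isGreedyPolicy hM.Qstar_mem).measurable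
    (fun h x => ((hM.unitMeasurable hM.Qstar_mem h).2 x).2) h x⟩

lemma bellman_Qstar (hM : Assumptions M F G greedy) (h : Fin H) :
    M.bellman h (entry M.Qstar (h + 1)) = M.Qstar h :=
  MDP.bellman_entry_Qstar (fun h x => (hM.r_mem_Icc h x).2) (hM.isGreedyPolicy hM.Qstar_mem) h

lemma Qstar_mem_prodClass_G (hM : Assumptions M F G greedy) : M.Qstar ∈ prodClass G := fun h _ => by
  rw [← hM.bellman_Qstar h]
  exact hM.bellman_mem hM.Qstar_mem h

section Nets

variable {ε : ℝ}

lemma abs_maxVal_sub_le (hM : Assumptions M F G greedy) (hf : f ∈ prodClass F)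
    (hg : g ∈ prodClass F) (hε : 0 ≤ ε) (hfg : ∀ h x, |f h x - g h x| ≤ ε) (j : ℕ) (s : S) :
    |maxVal (entry f j) s - maxVal (entry g j) s| ≤ ε :=
  (hM.isGreedyPolicy hf).abs_maxVal_entry_sub_le (hM.isGreedyPolicy hg) hε hfg j s

lemma abs_bellman_sub_le (hM : Assumptions M F G greedy) (hf : f ∈ prodClass F)
    (hg : g ∈ prodClass F) (hε : 0 ≤ ε) (hfg : ∀ h x, |f h x - g h x| ≤ ε) (h : Fin H)
    (x : S × A) :
    |M.bellman h (entry f (h + 1)) x - M.bellman h (entry g (h + 1)) x| ≤ ε := by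
  rw [MDP.bellman_apply, MDP.bellman_apply, add_sub_add_left_eq_sub]
  exact abs_integral_sub_integral_le (hM.unitMeasurable_maxVal hf _).bdd
    (hM.unitMeasurable_maxVal hg _).bdd (hM.abs_maxVal_sub_le hf hg hε hfg _)

lemma abs_resid_sub_le (hM : Assumptions M F G greedy) (hf : f ∈ prodClass F)
    (hg : g ∈ prodClass F) (hε : 0 ≤ ε) (hfg : ∀ h x, |f h x - g h x| ≤ ε) (h : Fin H)
    (x : S × A) : |M.resid f h x - M.resid g h x| ≤ 2 * ε := by
  have hval := abs_le.1 (hfg h x)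
  have hbell := abs_le.1 (hM.abs_bellman_sub_le hf hg hε hfg h x)
  simp only [MDP.resid, MDP.bellmanErr, abs_le]
  constructor <;> linarith

lemma excessLoss_le_add (hM : Assumptions M F G greedy) (hf : f ∈ prodClass F)
    (hg : g ∈ prodClass F) (hε : 0 ≤ ε) (hfg : ∀ h x, |f h x - g h x| ≤ ε) (h : Fin H)
    (y : (S × A) × S) :
    M.excessLoss h (f h) (entry f (h + 1)) y ≤
      M.excessLoss h (g h) (entry g (h + 1)) y + 12 * ε := by
  have hnoise : |M.bellman h (entry f (h + 1)) y.1 - M.r h y.1 -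
      maxVal (entry f (h + 1)) y.2| ≤ 1 := by
    have hv := hM.unitMeasurable_maxVal hf (h + 1)
    have hint := hv.integral_mem_Icc (M.P h y.1)
    rw [MDP.bellman_apply, add_sub_cancel_left]
    exact abs_sub_le_of_nonneg_of_le hint.1 hint.2 (hv.2 _).1 (hv.2 _).2
  have hnoise_sub : |(M.bellman h (entry f (h + 1)) y.1 - M.r h y.1 -
      maxVal (entry f (h + 1)) y.2) - (M.bellman h (entry g (h + 1)) y.1 - M.r h y.1 -
      maxVal (entry g (h + 1)) y.2)| ≤ 2 * ε := by
    have hbell := abs_le.1 (hM.abs_bellman_sub_le hf hg hε hfg h y.1)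
    have hval := abs_le.1 (hM.abs_maxVal_sub_le hf hg hε hfg (h + 1) y.2)
    rw [abs_le]
    constructor <;> linarith
  have hresid := hM.abs_resid_sub_le hf hg hε hfg h y.1
  have hsq := sq_le_sq_add_of_abs_sub_le (hM.abs_resid_le_one hf h y.1)
    (hM.abs_resid_le_one hg h y.1) hresid
  have hmul := mul_le_mul_add_of_abs_sub_le (hM.abs_resid_le_one hg h y.1) hnoise hresid
    hnoise_sub
  rw [MDP.excessLoss_eq, MDP.excessLoss_eq]
  linarith

lemma excessLoss_Qstar_le_add (hM : Assumptions M F G greedy) {h : Fin H} {u w : S × A → ℝ}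
    (hu : u ∈ G h) (hw : w ∈ G h) (huw : ∀ x, |u x - w x| ≤ ε) (y : (S × A) × S) :
    M.excessLoss h u (entry M.Qstar (h + 1)) y ≤
      M.excessLoss h w (entry M.Qstar (h + 1)) y + 4 * ε := by
  have hbound : ∀ v ∈ G h, |v y.1 - M.r h y.1 - maxVal (entry M.Qstar (h + 1)) y.2| ≤ 2 := by
    intro v hv
    have hv1 := (hM.unitMeasurable_G h v hv).2 y.1
    have hr1 := hM.r_mem_Icc h y.1
    have hm1 := (hM.unitMeasurable_maxVal hM.Qstar_mem (h + 1)).2 y.2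
    rw [abs_le]
    constructor <;> linarith [hv1.1, hv1.2, hr1.1, hr1.2, hm1.1, hm1.2]
  have hsq := sq_le_sq_add_of_abs_sub_le (e := ε) (hbound u hu) (hbound w hw)
    (by simpa only [sub_sub_sub_cancel_right] using huw y.1)
  simp only [MDP.excessLoss]
  linarith

end Nets

section GoodData

variable {n K : ℕ} {D : Fin n → Traj S A H} {Z : Finset (QTuple S A H)} {L β : ℝ}

-- `Q*_h` is its own regression target, so its loss exceeds that of `g ∈ G_h` by minus the excess
-- loss of `g`, and this is less than `L` at the points of the net.
lemma Qstar_mem_confSet (hM : Assumptions M F G greedy) (hn : n ≤ K)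
    (hZ : IsNet Z (prodClass G) (2 / K)) (hgood : ∀ h, ∀ z ∈ Z,
      ∑ t, (M.bellmanErr h (z h) (entry M.Qstar (h + 1)) (D t h).1 ^ 2 / 4 -
        M.excessLoss h (z h) (entry M.Qstar (h + 1)) (D t h)) < L) (hβ : L + 8 ≤ β) :
    M.Qstar ∈ M.confSet F G β D := by
  classical
  refine ⟨hM.Qstar_mem, fun h => ?_⟩
  have hne : Nonempty (G h) := ⟨⟨_, hM.bellman_mem hM.Qstar_mem h⟩⟩
  rw [← sub_le_iff_le_add]
  refine le_ciInf fun g => ?_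
  obtain ⟨z, hz, hgz⟩ := hZ.exists_abs_sub_le (Function.update M.Qstar h g)
    ((Set.update_mem_pi_iff_of_mem hM.Qstar_mem_prodClass_G).2 fun _ => g.2)
  have hgz : ∀ x, |z h x - g.1 x| ≤ 2 / K := fun x => by simpa [abs_sub_comm] using hgz h x
  have hexcess : ∑ t, M.excessLoss h (z h) (entry M.Qstar (h + 1)) (D t h) ≤
      ∑ t, M.excessLoss h g (entry M.Qstar (h + 1)) (D t h) + 8 :=
    sum_le_sum_add_of_le_add_div hn (by norm_num) fun t =>
      (hM.excessLoss_Qstar_le_add (hZ.mem z hz h trivial) g.2 hgz (D t h)).trans_eq (by ring)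
  have hloss := M.loss_sub_loss_bellman D h g (entry M.Qstar (h + 1))
  have hsq : 0 ≤ ∑ t, M.bellmanErr h (z h) (entry M.Qstar (h + 1)) (D t h).1 ^ 2 / 4 :=
    Finset.sum_nonneg fun _ _ => by positivity
  have hgood := hgood h z hz
  rw [Finset.sum_sub_distrib] at hgood
  rw [hM.bellman_Qstar] at hloss
  linarith

lemma sum_excessLoss_le_of_mem_confSet (hM : Assumptions M F G greedy)
    (hf : f ∈ M.confSet F G β D) (h : Fin H) :
    ∑ t, M.excessLoss h (f h) (entry f (h + 1)) (D t h) ≤ β := by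
  rw [← MDP.loss_sub_loss_bellman, sub_le_iff_le_add']
  exact (hf.2 h).trans (by gcongr; exact M.iInf_loss_le D h _ (hM.bellman_mem hf.1 h))

lemma sum_integral_sq_resid_le (hM : Assumptions M F G greedy) (hn : n ≤ K)
    (hZ : IsNet Z (prodClass F) (2 / K)) {ν : Fin n → Measure (S × A)}
    [∀ t, IsProbabilityMeasure (ν t)] {h : Fin H} (hgood : ∀ z ∈ Z,
      ∑ t, ((∫ x, M.resid z h x ^ 2 ∂(ν t)) / 4 -
        M.excessLoss h (z h) (entry z (h + 1)) (D t h)) < L) (hf : f ∈ M.confSet F G β D) :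
    ∑ t, ∫ x, M.resid f h x ^ 2 ∂(ν t) ≤ 4 * (β + 24 + L) + 8 := by
  obtain ⟨z, hz, hfz⟩ := hZ.exists_abs_sub_le f hf.1
  have hzF := hZ.mem z hz
  have hε : (0 : ℝ) ≤ 2 / K := by positivity
  have hexcess : ∑ t, M.excessLoss h (z h) (entry z (h + 1)) (D t h) ≤
      ∑ t, M.excessLoss h (f h) (entry f (h + 1)) (D t h) + 24 :=
    sum_le_sum_add_of_le_add_div hn (by norm_num) fun t => (hM.excessLoss_le_add hzF hf.1 hε
      (fun h x => by simpa [abs_sub_comm] using hfz h x) h (D t h)).trans_eq (by ring)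
  have hsq : ∀ w ∈ prodClass F, BddMeasurable fun x => M.resid w h x ^ 2 := fun w hw =>
    .sq ⟨hM.measurable_resid hw h, 1, hM.abs_resid_le_one hw h⟩
  have hint (t : Fin n) :
      ∫ x, M.resid f h x ^ 2 ∂(ν t) ≤ (∫ x, M.resid z h x ^ 2 ∂(ν t)) + 8 / K :=
    calc ∫ x, M.resid f h x ^ 2 ∂(ν t) ≤ ∫ x, (M.resid z h x ^ 2 + 8 / K) ∂(ν t) :=
          integral_mono ((hsq f hf.1).integrable _)
            (((hsq z hzF).integrable _).add (integrable_const _)) fun x =>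
              (sq_le_sq_add_of_abs_sub_le (hM.abs_resid_le_one hf.1 h x)
                (hM.abs_resid_le_one hzF h x) (hM.abs_resid_sub_le hf.1 hzF hε hfz h x)).trans_eq
                (by ring)
      _ = (∫ x, M.resid z h x ^ 2 ∂(ν t)) + 8 / K := by
          rw [integral_add ((hsq z hzF).integrable _) (integrable_const _)]
          simp
  have hresid := sum_le_sum_add_of_le_add_div hn (by norm_num) hint
  have hconf := hM.sum_excessLoss_le_of_mem_confSet hf h
  have hgood := hgood z hz
  rw [Finset.sum_sub_distrib, ← Finset.sum_div] at hgood
  linarith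

end GoodData

end Assumptions

end ConfidenceSets

section Arithmetic

lemma sum_filter_lt_eq_sum_castLE {k : ℕ} (t : Fin k) (a : Fin k → ℝ) :
    ∑ i with i < t, a i = ∑ i : Fin t, a (Fin.castLE t.isLt.le i) := by
  have hfilter : ({i | i < t} : Finset (Fin k)) = Finset.univ.map (Fin.castLEEmb t.isLt.le) := by
    ext i
    simp only [Finset.mem_filter_univ, Finset.mem_map, Finset.mem_univ, true_and]
    exact ⟨fun hi => ⟨⟨i, hi⟩, rfl⟩, fun ⟨j, hj⟩ => hj ▸ j.isLt⟩
  rw [hfilter, Finset.sum_map]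
  rfl

lemma sum_le_two_mul_sqrt {n : ℕ} {x : Fin n → ℝ} {L : ℝ} (hL : 0 < L)
    (hx : ∑ t, (√(L / n) * x t - √(L / n) ^ 2 / 2) < L) : ∑ t, x t ≤ 2 * √(n * L) := by
  obtain rfl | hn := n.eq_zero_or_pos
  · simp
  have hn : (0 : ℝ) < n := by exact_mod_cast hn
  have hsq : √(L / n) ^ 2 = L / n := Real.sq_sqrt (by positivity)
  have hprod : √(L / n) * √(n * L) = L := by
    rw [← Real.sqrt_mul (by positivity), show L / n * (n * L) = L ^ 2 by field_simp,
      Real.sqrt_sq hL.le]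
  rw [Finset.sum_sub_distrib, ← Finset.mul_sum, Finset.sum_const, Finset.card_univ,
    Fintype.card_fin, nsmul_eq_mul, hsq, show (n : ℝ) * (L / n / 2) = L / 2 by field_simp] at hx
  refine le_of_mul_le_mul_left ?_ (Real.sqrt_pos.2 (div_pos hL hn))
  linarith

lemma eluder_bound_le {k K d : ℕ} (hk : k ≤ K) {β : ℝ} (hβ : 1 ≤ β) :
    k * (1 / √K) + 2 * √(d * (16 * β) * k) + √(d * k) ≤ 10 * √(max (d : ℝ) 1 * k * β) := by
  have hmain : √(d * (16 * β) * k) = 4 * √(d * k * β) := by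
    rw [show d * (16 * β) * k = 4 ^ 2 * (d * k * β) by ring, Real.sqrt_mul (by norm_num),
      Real.sqrt_sq (by norm_num)]
  have hwidth : k * (1 / √K) ≤ √(1 * k * 1) := by
    rw [mul_one_div, one_mul, mul_one]
    refine div_le_of_le_mul₀ (Real.sqrt_nonneg _) (Real.sqrt_nonneg _) ?_
    calc (k : ℝ) = √k * √k := (Real.mul_self_sqrt k.cast_nonneg).symm
      _ ≤ √k * √K := by gcongr
  have hone : √(1 * k * 1) ≤ √(max (d : ℝ) 1 * k * β) := by gcongr; exact le_max_right _ _
  have hdβ : √(d * k * β) ≤ √(max (d : ℝ) 1 * k * β) := by gcongr; exact le_max_left _ _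
  have hd : √(d * k * 1) ≤ √(d * k * β) := by gcongr
  rw [mul_one] at hd
  linarith

end Arithmetic

section Regret

variable {S A : Type*} [MeasurableSpace S] [MeasurableSpace A] {H : ℕ} {M : MDP S A H}
  {F G : Fin H → Set (S × A → ℝ)} {greedy : QTuple S A H → Policy S A H}
  {sel : (k : ℕ) → (Fin k → Traj S A H) → QTuple S A H} {ZF ZG : Finset (QTuple S A H)}

/-- The tuple chosen before episode `t` (counted from `0`) of the run with record `D`. -/
def played (sel : (k : ℕ) → (Fin k → Traj S A H) → QTuple S A H) {k : ℕ}
    (D : Fin k → Traj S A H) (t : Fin k) : QTuple S A H :=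
  sel t (MDP.pre D t t.isLt.le)

/-- The record `D` is typical: the sums of the exponential supermartingales attached to the nets
`ZF` and `ZG`, and of the one that compares the residuals of the played tuples with their
expectations, stay below the level `L`. -/
structure IsTypical (M : MDP S A H) (greedy : QTuple S A H → Policy S A H)
    (sel : (k : ℕ) → (Fin k → Traj S A H) → QTuple S A H) (ZF ZG : Finset (QTuple S A H)) (L : ℝ)
    {n : ℕ} (D : Fin n → Traj S A H) : Prop where
  empirical : ∀ h, ∀ z ∈ ZF, ∑ t, (M.resid z h (D t h).1 ^ 2 / 4 -
    M.excessLoss h (z h) (entry z (h + 1)) (D t h)) < L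
  population : ∀ h, ∀ z ∈ ZF, ∑ t, ((∫ x, M.resid z h x ^ 2 ∂(M.occ (greedy (played sel D t)) h))
    / 4 - M.excessLoss h (z h) (entry z (h + 1)) (D t h)) < L
  optimal : ∀ h, ∀ z ∈ ZG, ∑ t,
    (M.bellmanErr h (z h) (entry M.Qstar (h + 1)) (D t h).1 ^ 2 / 4 -
      M.excessLoss h (z h) (entry M.Qstar (h + 1)) (D t h)) < L
  deviation : ∀ h, ∑ t, (√(L / n) *
    ((∫ x, M.resid (played sel D t) h x ∂(M.occ (greedy (played sel D t)) h)) -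
      M.resid (played sel D t) h (D t h).1) - √(L / n) ^ 2 / 2) < L

namespace Assumptions

variable {k K d : ℕ} {D : Fin k → Traj S A H} {L β : ℝ} {h : Fin H}

lemma sum_integral_resid_played_le (hM : Assumptions M F G greedy) (hk : k ≤ K)
    (hZ : IsNet ZF (prodClass F) (2 / K)) (hL : 8 / 3 ≤ L) (hβ : 4 * L ≤ β)
    (hconf : ∀ t : Fin k, played sel D t ∈ M.confSet F G β (MDP.pre D t t.isLt.le))
    {Ps : Set (Measure (S × A))} (hd : deDim (M.residuals F h) Ps (1 / √K) ≤ d)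
    {ν : Fin k → Measure (S × A)} [∀ t, IsProbabilityMeasure (ν t)] (hν : ∀ t, ν t ∈ Ps)
    (htyp : ∀ t : Fin k, ∀ z ∈ ZF, ∑ i : Fin t,
      ((∫ x, M.resid z h x ^ 2 ∂(ν (Fin.castLE t.isLt.le i))) / 4 -
        M.excessLoss h (z h) (entry z (h + 1)) (MDP.pre D t t.isLt.le i h)) < L) :
    ∑ t, ∫ x, M.resid (played sel D t) h x ∂(ν t) ≤ 10 * √(max (d : ℝ) 1 * k * β) := by
  obtain rfl | hk0 := k.eq_zero_or_pos
  · simp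
  have hK : (0 : ℝ) < K := by exact_mod_cast hk0.trans_le hk
  have hF (t : Fin k) : played sel D t ∈ prodClass F := (hconf t).1
  have hsq (t : Fin k) :
      ∑ i with i < t, ∫ x, M.resid (played sel D t) h x ^ 2 ∂(ν i) ≤ 16 * β := by
    rw [sum_filter_lt_eq_sum_castLE]
    refine (hM.sum_integral_sq_resid_le (t.isLt.le.trans hk) hZ (htyp t) (hconf t)).trans ?_
    linarith
  calc ∑ t, ∫ x, M.resid (played sel D t) h x ∂(ν t)
      ≤ ∑ t, |∫ x, M.resid (played sel D t) h x ∂(ν t)| :=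
        Finset.sum_le_sum fun _ _ => le_abs_self _
    _ ≤ (Finset.univ : Finset (Fin k)).card * (1 / √K) + 2 * √(d * (16 * β) *
          (Finset.univ : Finset (Fin k)).card) + √(d * (Finset.univ : Finset (Fin k)).card) :=
        sum_abs_integral_le (by positivity) hd (fun t _ => ⟨_, hF t, rfl⟩)
          (fun t _ => hM.measurable_resid (hF t) h) (fun t _ => hM.abs_resid_le_one (hF t) h)
          (fun t _ => hν t) (by linarith) fun t _ => hsq t
    _ ≤ _ := by
        rw [Finset.card_univ, Fintype.card_fin]
        exact eluder_bound_le hk (by linarith)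

-- For the point masses the bound controls the residuals along the trajectories; a martingale
-- deviation bound then transfers it to their expectations.
lemma sum_integral_resid_occ_le (hM : Assumptions M F G greedy) (hk : k ≤ K)
    (hZ : IsNet ZF (prodClass F) (2 / K)) (hL : 8 / 3 ≤ L) (hβ : 4 * L ≤ β)
    (hconf : ∀ t : Fin k, played sel D t ∈ M.confSet F G β (MDP.pre D t t.isLt.le))
    (hd : deDim (M.residuals F h) (diracFamily S A) (1 / √K) ≤ d ∨
      deDim (M.residuals F h) (M.greedyFamily F greedy h) (1 / √K) ≤ d)
    (htyp : ∀ n (hn : n ≤ k), IsTypical M greedy sel ZF ZG L (MDP.pre D n hn)) :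
    ∑ t, ∫ x, M.resid (played sel D t) h x ∂(M.occ (greedy (played sel D t)) h) ≤
      12 * √(max (d : ℝ) 1 * k * β) := by
  obtain hd | hd := hd
  · have hdirac {f : QTuple S A H} (hf : f ∈ prodClass F) (x : S × A) :
        ∫ y, M.resid f h y ∂(Measure.dirac x) = M.resid f h x :=
      integral_dirac' _ _ (hM.measurable_resid hf h).stronglyMeasurable
    have hdirac_sq {f : QTuple S A H} (hf : f ∈ prodClass F) (x : S × A) :
        ∫ y, M.resid f h y ^ 2 ∂(Measure.dirac x) = M.resid f h x ^ 2 :=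
      integral_dirac' _ _ ((hM.measurable_resid hf h).pow_const 2).stronglyMeasurable
    have heluder := hM.sum_integral_resid_played_le hk hZ hL hβ hconf hd
      (ν := fun t => Measure.dirac (D t h).1) (fun t => ⟨_, rfl⟩) fun t z hz => by
        simp only [hdirac_sq (hZ.mem z hz)]
        exact (htyp t t.isLt.le).empirical h z hz
    have hdev := sum_le_two_mul_sqrt (by linarith) ((htyp k le_rfl).deviation h)
    have hsqrt : √(k * L) ≤ √(max (d : ℝ) 1 * k * β) := by
      gcongr
      · exact le_mul_of_one_le_left k.cast_nonneg (le_max_right _ _)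
      · linarith
    simp only [hdirac (hconf _).1] at heluder
    rw [Finset.sum_sub_distrib, sub_le_iff_le_add] at hdev
    calc _ ≤ 2 * √(k * L) + ∑ t, M.resid (played sel D t) h (D t h).1 := hdev
      _ ≤ _ := by linarith
  · have hprob (t : Fin k) : IsProbabilityMeasure (M.occ (greedy (played sel D t)) h) :=
      MDP.isProbabilityMeasure_occ (hM.isGreedyPolicy (hconf t).1).measurable h
    refine (hM.sum_integral_resid_played_le hk hZ hL hβ hconf hd
      (ν := fun t => M.occ (greedy (played sel D t)) h) (fun t => ⟨_, (hconf t).1, rfl⟩)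
      fun t => (htyp t t.isLt.le).population h).trans ?_
    gcongr
    norm_num

lemma regret_le [NeZero H] (hM : Assumptions M F G greedy) (hsel : IsGolf M F G K β greedy sel)
    (hk : k ≤ K) (hZF : IsNet ZF (prodClass F) (2 / K)) (hZG : IsNet ZG (prodClass G) (2 / K))
    (hL : 8 / 3 ≤ L) (hβ : 4 * L ≤ β)
    (hd : (∀ h, deDim (M.residuals F h) (diracFamily S A) (1 / √K) ≤ d) ∨
      ∀ h, deDim (M.residuals F h) (M.greedyFamily F greedy h) (1 / √K) ≤ d)
    (htyp : ∀ n (hn : n ≤ k), IsTypical M greedy sel ZF ZG L (MDP.pre D n hn)) :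
    M.regret (fun t D' => greedy (sel t D')) D k le_rfl ≤
      12 * H * √(max (d : ℝ) 1 * k * β) := by
  have hr (h x) : M.r h x ≤ 1 := (hM.r_mem_Icc h x).2
  have hopt (t : Fin k) : M.Qstar ∈ M.confSet F G β (MDP.pre D t t.isLt.le) :=
    hM.Qstar_mem_confSet (t.isLt.le.trans hk) hZG (htyp t t.isLt.le).optimal (by linarith)
  have hconf (t : Fin k) : played sel D t ∈ M.confSet F G β (MDP.pre D t t.isLt.le) :=
    hsel.mem_confSet t (t.isLt.trans_le hk) _ ⟨_, hopt t⟩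
  have hstep (t : Fin k) : M.Vstar 0 M.s₁ - M.V (greedy (played sel D t)) 0 M.s₁ ≤
      ∑ h, ∫ x, M.resid (played sel D t) h x ∂(M.occ (greedy (played sel D t)) h) := by
    rw [← MDP.sub_V_eq_sum_integral_resid hr (hM.unitMeasurable (hconf t).1)
      (hM.isGreedyPolicy (hconf t).1)]
    gcongr
    exact (MDP.Vstar_zero_le_Qstar hr (hM.isGreedyPolicy hM.Qstar_mem) M.s₁).trans
      (hsel.isMax t (t.isLt.trans_le hk) _ _ (hopt t))
  calc M.regret (fun t D' => greedy (sel t D')) D k le_rfl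
      ≤ ∑ t, ∑ h, ∫ x, M.resid (played sel D t) h x ∂(M.occ (greedy (played sel D t)) h) :=
        Finset.sum_le_sum fun t _ => hstep t
    _ = ∑ h, ∑ t, ∫ x, M.resid (played sel D t) h x ∂(M.occ (greedy (played sel D t)) h) :=
        Finset.sum_comm
    _ ≤ ∑ _h : Fin H, 12 * √(max (d : ℝ) 1 * k * β) :=
        Finset.sum_le_sum fun h _ => hM.sum_integral_resid_occ_le hk hZF hL hβ hconf
          (hd.imp (fun hd => hd h) fun hd => hd h) htyp
    _ = 12 * H * √(max (d : ℝ) 1 * k * β) := by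
        rw [Finset.sum_const, Finset.card_univ, Fintype.card_fin, nsmul_eq_mul]
        ring

end Assumptions

end Regret

section Confidence

variable {N K H δ : ℝ}

lemma two_le_mul_div (hN : 1 ≤ N) (hK : 2 ≤ K) (hH : 1 ≤ H) (hδ : 0 < δ) (hδ1 : δ ≤ 1) :
    2 ≤ N * (K * H) / δ := by
  have hprod : (1 : ℝ) * (2 * 1) ≤ N * (K * H) := by gcongr
  rw [le_div_iff₀ hδ]
  linarith

lemma eight_thirds_le_four_mul_log {y : ℝ} (hy : 2 ≤ y) : 8 / 3 ≤ 4 * Real.log y := by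
  linarith [Real.log_le_log two_pos hy, Real.log_two_gt_d9]

lemma mul_exp_neg_four_mul_log_le (hN : 1 ≤ N) (hK : 2 ≤ K) (hH : 1 ≤ H) (hδ : 0 < δ)
    (hδ1 : δ ≤ 1) :
    (K + 1) * (H * (3 * N + 1)) * Real.exp (-(4 * Real.log (N * (K * H) / δ))) ≤ δ := by
  have hy2 := two_le_mul_div hN hK hH hδ hδ1
  set y := N * (K * H) / δ with hy
  have hy0 : 0 < y := two_pos.trans_le hy2
  have hexp : Real.exp (-(4 * Real.log y)) = (y ^ 4)⁻¹ := by
    rw [Real.exp_neg, show (4 : ℝ) = (4 : ℕ) by norm_num, Real.exp_nat_mul, Real.exp_log hy0]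
  have hcube : (8 : ℝ) ≤ y ^ 3 := by
    calc (8 : ℝ) = 2 ^ 3 := by norm_num
      _ ≤ y ^ 3 := by gcongr
  rw [hexp, ← div_eq_mul_inv, div_le_iff₀ (by positivity)]
  calc (K + 1) * (H * (3 * N + 1)) ≤ (2 * K) * (H * (4 * N)) := by gcongr <;> linarith
    _ = 8 * (y * δ) := by rw [hy, div_mul_cancel₀ _ hδ.ne']; ring
    _ ≤ y ^ 3 * (y * δ) := by gcongr
    _ = δ * y ^ 4 := by ring

end Confidence

section TypicalEvent

variable {S A : Type*} [MeasurableSpace S] [MeasurableSpace A] {H : ℕ} {M : MDP S A H}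
  {F G : Fin H → Set (S × A → ℝ)} {greedy : QTuple S A H → Policy S A H} {K : ℕ} {β : ℝ}
  {sel : (k : ℕ) → (Fin k → Traj S A H) → QTuple S A H} {ZF ZG : Finset (QTuple S A H)}

/-- The increments of the supermartingales of `IsTypical`. The index consists of the number of
episodes, the step, and a net point or, for the deviation of the residuals, `()`. -/
def increment (M : MDP S A H) (greedy : QTuple S A H → Policy S A H)
    (sel : (k : ℕ) → (Fin k → Traj S A H) → QTuple S A H) (ZF ZG : Finset (QTuple S A H))
    (K : ℕ) (L : ℝ) : Fin (K + 1) × Fin H × (ZF ⊕ ZF ⊕ ZG ⊕ Unit) →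
      (t : ℕ) → (Fin t → Traj S A H) → Traj S A H → ℝ
  | (_, h, .inl z), _, _, τ =>
      M.resid z.1 h (τ h).1 ^ 2 / 4 - M.excessLoss h (z.1 h) (entry z.1 (h + 1)) (τ h)
  | (_, h, .inr (.inl z)), t, D, τ =>
      (∫ x, M.resid z.1 h x ^ 2 ∂(M.occ (greedy (sel t D)) h)) / 4 -
        M.excessLoss h (z.1 h) (entry z.1 (h + 1)) (τ h)
  | (_, h, .inr (.inr (.inl z))), _, _, τ =>
      M.bellmanErr h (z.1 h) (entry M.Qstar (h + 1)) (τ h).1 ^ 2 / 4 -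
        M.excessLoss h (z.1 h) (entry M.Qstar (h + 1)) (τ h)
  | (n, h, .inr (.inr (.inr ()))), t, D, τ =>
      √(L / n) * ((∫ x, M.resid (sel t D) h x ∂(M.occ (greedy (sel t D)) h)) -
        M.resid (sel t D) h (τ h).1) - √(L / n) ^ 2 / 2

lemma isTypical_of_cumSum_increment_lt {L : ℝ} {n : ℕ} (hn : n ≤ K) {D : Fin n → Traj S A H}
    (hD : ∀ i, MDP.cumSum (increment M greedy sel ZF ZG K L (⟨n, Nat.lt_succ_of_le hn⟩, i)) D < L) :
    IsTypical M greedy sel ZF ZG L D where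
  empirical h z hz := hD (h, .inl ⟨z, hz⟩)
  population h z hz := hD (h, .inr (.inl ⟨z, hz⟩))
  optimal h z hz := hD (h, .inr (.inr (.inl ⟨z, hz⟩)))
  deviation h := hD (h, .inr (.inr (.inr ())))

namespace Assumptions

variable [NeZero H] {t : ℕ}

lemma measurable_maxVal_entry_sel (hM : Assumptions M F G greedy)
    (hsel : IsGolf M F G K β greedy sel) (ht : t < K) (j : ℕ) :
    Measurable fun p : (Fin t → Traj S A H) × S => maxVal (entry (sel t p.1) j) p.2 := by
  obtain hj | hj := lt_or_ge j H
  · simp only [entry_of_lt _ hj, (hM.isGreedyPolicy (hsel.mem t ht _)).maxVal_eq]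
    exact (hsel.measurable_sel t ht ⟨j, hj⟩).comp (measurable_fst.prodMk
      (measurable_snd.prodMk (hsel.measurable_policy t ht ⟨j, hj⟩)))
  · simp only [entry_of_le _ hj, maxVal_zero]
    exact measurable_const

lemma measurable_resid_sel (hM : Assumptions M F G greedy) (hsel : IsGolf M F G K β greedy sel)
    (ht : t < K) (h : Fin H) :
    Measurable fun p : (Fin t → Traj S A H) × (S × A) => M.resid (sel t p.1) h p.2 := by
  refine (hsel.measurable_sel t ht h).sub (((M.measurable_r h).comp measurable_snd).add ?_)
  exact measurable_integral_of_measurable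
    (κ := fun p : (Fin t → Traj S A H) × (S × A) => M.P h p.2)
    ((M.P h).measurable.comp measurable_snd)
    (F := fun p => maxVal (entry (sel t p.1) (h + 1)))
    ((hM.measurable_maxVal_entry_sel hsel ht (h + 1)).comp
      ((measurable_fst.comp measurable_fst).prodMk measurable_snd))

lemma isExpSupermartingale_increment (hM : Assumptions M F G greedy)
    (hsel : IsGolf M F G K β greedy sel) (hZF : ∀ z ∈ ZF, z ∈ prodClass F)
    (hZG : ∀ z ∈ ZG, z ∈ prodClass G) (L : ℝ)
    (i : Fin (K + 1) × Fin H × (ZF ⊕ ZF ⊕ ZG ⊕ Unit)) :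
    MDP.IsExpSupermartingale M (fun t D => greedy (sel t D)) K
      (increment M greedy sel ZF ZG K L i) := by
  have hpol : MDP.MeasurablePol (fun t D => greedy (sel t D)) K := hsel.measurable_policy
  obtain ⟨n, h, z | z | z | -⟩ := i
  · exact MDP.isExpSupermartingale_empirical hpol (hM.unitMeasurable (hZF z z.2) h)
      (hM.unitMeasurable_maxVal (hZF z z.2) _) (hM.unitMeasurable_bellman (hZF z z.2) h)
  · exact MDP.isExpSupermartingale_population hpol (hM.unitMeasurable (hZF z z.2) h)
      (hM.unitMeasurable_maxVal (hZF z z.2) _) (hM.unitMeasurable_bellman (hZF z z.2) h)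
  · exact MDP.isExpSupermartingale_empirical hpol
      (hM.unitMeasurable_G h _ (hZG z z.2 h trivial)) (hM.unitMeasurable_maxVal hM.Qstar_mem _)
      (hM.unitMeasurable_bellman hM.Qstar_mem h)
  · exact MDP.isExpSupermartingale_deviation hpol h (φ := fun t D => M.resid (sel t D) h)
      (fun t ht => hM.measurable_resid_sel hsel ht h)
      (fun t ht D => hM.abs_resid_le_one (hsel.mem t ht D) h) _

lemma one_sub_le_runLaw_isTypical (hM : Assumptions M F G greedy)
    (hsel : IsGolf M F G K β greedy sel) (hZF : ∀ z ∈ ZF, z ∈ prodClass F)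
    (hZG : ∀ z ∈ ZG, z ∈ prodClass G) (L : ℝ) :
    ENNReal.ofReal (1 - (K + 1) * (H * (2 * ZF.card + ZG.card + 1)) * Real.exp (-L)) ≤
      M.runLaw (fun t D => greedy (sel t D)) K
        {D | ∀ n (hn : n ≤ K), IsTypical M greedy sel ZF ZG L (MDP.pre D n hn)} := by
  have hcard : (Fintype.card (Fin (K + 1) × Fin H × (ZF ⊕ ZF ⊕ ZG ⊕ Unit)) : ℝ) =
      (K + 1) * (H * (2 * ZF.card + ZG.card + 1)) := by
    simp only [Fintype.card_prod, Fintype.card_fin, Fintype.card_sum, Fintype.card_coe,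
      Fintype.card_unit]
    push_cast
    ring
  have hpol : MDP.MeasurablePol (fun t D => greedy (sel t D)) K := hsel.measurable_policy
  rw [← hcard]
  refine (MDP.one_sub_le_runLaw_forall_cumSum_lt hpol (fun i => Nat.le_of_lt_succ i.1.isLt)
    (hM.isExpSupermartingale_increment hsel hZF hZG L) L).trans (measure_mono ?_)
  exact fun D hD n hn => isTypical_of_cumSum_increment_lt hn fun i => hD (_, i)

end Assumptions

end TypicalEvent

end Golf

end

theorem theorem1 :
    ∃ c C : ℝ, 0 < c ∧ 0 < C ∧
      ∀ (S : Type*) (A : Type*) [MeasurableSpace S] [MeasurableSpace A]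
        (H : ℕ) [NeZero H] (M : Golf.MDP S A H)
        (F G : Fin H → Set (S × A → ℝ))
        (_ : ∀ h, ∀ f ∈ F h, Measurable f ∧ ∀ x, f x ∈ Set.Icc (0 : ℝ) 1)
        (_ : ∀ h, ∀ g ∈ G h, Measurable g ∧ ∀ x, g x ∈ Set.Icc (0 : ℝ) 1)
        (greedy : Golf.QTuple S A H → Golf.Policy S A H) (_ : Golf.IsGreedy F greedy)
        (_ : M.Realizable F) (_ : M.Complete F G)
        (δ : ℝ) (_ : 0 < δ) (_ : δ ≤ 1) (K : ℕ) (_ : 2 ≤ K)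
        (N : ℕ)
        (_ : Golf.coverNum (Golf.prodClass F ∪ Golf.prodClass G) (1 / (K : NNReal)) = N)
        (d : ℕ)
        (_ : min (M.beDim F (fun _ => Golf.diracFamily S A) (1 / Real.sqrt K))
          (M.beDim F (M.greedyFamily F greedy) (1 / Real.sqrt K)) = d)
        (β : ℝ) (_ : β = c * Real.log (N * (K * H) / δ))
        (sel : (k : ℕ) → (Fin k → Golf.Traj S A H) → Golf.QTuple S A H)
        (_ : Golf.IsGolf M F G K β greedy sel),
        ENNReal.ofReal (1 - δ) ≤
          M.runLaw (fun t D => greedy (sel t D)) K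
            {D | ∀ (k : ℕ) (hk : k ≤ K),
              M.regret (fun t D' => greedy (sel t D')) D k hk ≤
                C * H * Real.sqrt (max d 1 * k * β)} := by
  refine ⟨16, 12, by norm_num, by norm_num, ?_⟩
  intro S A _ _ H _ M F G hF hG greedy hgreedy hreal hcomp δ hδ hδ1 K hK N hN d hd β hβ sel hsel
  have hM : Golf.Assumptions M F G greedy := ⟨hF, hG, hgreedy, hreal, hcomp⟩
  obtain ⟨ZF, hZF, hZFN⟩ := Golf.exists_isNet_of_subset Set.subset_union_left hN
  obtain ⟨ZG, hZG, hZGN⟩ := Golf.exists_isNet_of_subset Set.subset_union_right hN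
  have hN1 : (1 : ℝ) ≤ N := by
    exact_mod_cast hN ▸ Golf.one_le_coverNum ⟨_, Or.inl hM.Qstar_mem⟩ (1 / (K : NNReal))
  have hK2 : (2 : ℝ) ≤ K := by exact_mod_cast hK
  have hH1 : (1 : ℝ) ≤ H := by exact_mod_cast NeZero.one_le
  have hL := Golf.eight_thirds_le_four_mul_log (Golf.two_le_mul_div hN1 hK2 hH1 hδ hδ1)
  have hd' := (min_le_iff.1 hd.le).imp iSup_le_iff.1 iSup_le_iff.1
  refine (ENNReal.ofReal_le_ofReal ?_).trans
    ((hM.one_sub_le_runLaw_isTypical hsel hZF.mem hZG.mem (4 * Real.log (N * (K * H) / δ))).trans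
      (measure_mono fun D hD k hk => ?_))
  · have hcard : 2 * (ZF.card : ℝ) + ZG.card + 1 ≤ 3 * N + 1 := by
      exact_mod_cast (by omega : 2 * ZF.card + ZG.card + 1 ≤ 3 * N + 1)
    refine sub_le_sub_left (le_trans ?_
      (Golf.mul_exp_neg_four_mul_log_le hN1 hK2 hH1 hδ hδ1)) 1
    gcongr
  · rw [Nat.cast_max, Nat.cast_one]
    exact hM.regret_le (D := Golf.MDP.pre D k hk) hsel hk hZF hZG hL (by linarith) hd'
      fun n hn => hD n (hn.trans hk)
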